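/- Let $f(\delta)=\delta$ for $0\le\delta\le 2/3$, $f(\delta)=4\delta-2$ for $2/3\le\delta\le 3/4$, and $f(\delta)=1$ for $3/4\le\delta\le 1$. A balanced bipartite graph on $2n$ vertices is a graph whose vertex set is partitioned into two independent sets of size $n$. A 2-coloring of a graph $G$ writes its edge set as $E(G)=E_R\cup E_B$ (where $E_R\cap E_B$ need not be empty), and a monochromatic cycle is a cycle all of whose edges lie in $E_R$ or all of whose edges lie in $E_B$; its order is its number of vertices. (i) For all $0<\delta\le 1$ and $\varepsilon>0$ there exists $n_0$ such that for every $n\ge n_0$, if $G$ is a balanced bipartite graph on $2n$ vertices with minimum degree at least $\delta n$, then every 2-coloring of the edges of $G$ contains a monochromatic cycle of order at least $(f(\delta)-\varepsilon)n$. (ii) This bound is asymptotically tight: for all $0\le\delta\le 1$ and $\varepsilon>0$ there exists $n_0$ such that for every $n\ge n_0$ there is a balanced bipartite graph $G$ on $2n$ vertices with minimum degree exactly $\lceil\delta n\rceil$, and a 2-coloring of its edges with $E_R\cap E_B=\emptyset$, in which every monochromatic cycle has order at most $(f(\delta)+\varepsilon)n$. -/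

import Mathlib

/-- `G` is a balanced bipartite graph on `2 * n` vertices: its vertex set is partitioned into two
independent sets `X` and `Y` of size `n` each. -/
def IsBalancedBipartite {V : Type*} [Fintype V] (G : SimpleGraph V) (n : ℕ) : Prop :=
  ∃ X Y : Finset V, G.IsBipartiteWith (X : Set V) (Y : Set V) ∧
    (∀ v : V, v ∈ X ∨ v ∈ Y) ∧ X.card = n ∧ Y.card = n

/-- `R` (the red edges) and `B` (the blue edges) form a 2-coloring of the edges of `G`:
`E(G) = E(R) ∪ E(B)`. An edge is allowed to receive both colors. -/
def IsTwoColoring {V : Type*} (G R B : SimpleGraph V) : Prop :=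
  R ⊔ B = G

/-- `H` contains a cycle of order `m`, that is, with exactly `m` vertices (equivalently,
since a cycle has as many vertices as edges, of length `m`). -/
def HasCycleOfOrder {V : Type*} (H : SimpleGraph V) (m : ℕ) : Prop :=
  ∃ (v : V) (p : H.Walk v v), p.IsCycle ∧ p.length = m

/-- In the 2-coloring with red graph `R` and blue graph `B` there is a monochromatic cycle
of order `m`. -/
def HasMonoCycleOfOrder {V : Type*} (R B : SimpleGraph V) (m : ℕ) : Prop :=
  HasCycleOfOrder R m ∨ HasCycleOfOrder B m

/-- The function equal to `δ` on `[0, 2/3]`, to `4 δ - 2` on `[2/3, 3/4]`, and to `1` on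
`[3/4, 1]`. -/
noncomputable def circBound (δ : ℝ) : ℝ :=
  if δ ≤ 2 / 3 then δ else if δ ≤ 3 / 4 then 4 * δ - 2 else 1

/-! The lower bound uses Łuczak's method of connected matchings. The two sides are cut into
boundedly many parts of equal size, and each color defines a cluster graph on the parts. A matching
with `k` edges inside one component of a cluster graph lifts to a cycle of that color filling almost
all of its `2 * k` clusters (`SimpleGraph.exists_cycle_of_hasConnectedMatching`). It then suffices
to find a monochromatic connected matching of the right size in a bipartite graph with slightly
smaller relative minimum degree.

Densities are not needed for the lift. It is enough that almost every pair of parts, in each color,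
has either no edge at all or an edge between any two large subsets (`EqualParts.exists_regular`).
Pairs violating this are refined along their holes, which increases the number of vertex pairs in
edgeless pairs of parts; this number is at most `2 * n ^ 2` over both colors, so the process stops.
In a pair without holes, depth-first search finds an almost spanning path, and the same property
links such paths into a cycle.

For the matching (`exists_mono_connectedMatching`), suppose that neither color has a connected
matching of size `k`. Kőnig's theorem in every component gives sets `T` and `S` that cover the red
and the blue edges with fewer than `k` vertices per component. If `2 * k ≤ d`, every vertex must lie
in `T` or `S`, and counting leaves no slack (`false_of_small_covers`). If `3 * d > 2 * n`, `2 * k ≤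
n` and `k + n ≤ 2 * d`, two vertices of a side have `k` common neighbors and three have at least
one. Labelling each vertex by its red and its blue component, this forces all vertices of `X` into
one red or one blue component, which is refuted by counting (`LabelledCover.false_of_attained`). The
choices `d / 2` and `min (n / 2) (2 * d - n)` for `k` yield the three pieces of `circBound`.

For tightness, a cycle lies in one component, and `t` vertices covering the edges there bound its
order by `2 * t`. Three colored patterns on `4 + 4` vertices are blown up so that all components
have small covers (`exists_blowup`). -/

section Counting

open Finset
open scoped Classical

/-- The number of elements of `X` that satisfy `P`. -/
noncomputable def Finset.count {V : Type*} (X : Finset V) (P : V → Prop) : ℕ := #{v ∈ X | P v}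

/-! ### Counting elements of finite sets. -/

namespace Finset

variable {V : Type*} {X : Finset V} {P Q R : V → Prop}

lemma count_mono (h : ∀ x ∈ X, P x → Q x) : X.count P ≤ X.count Q :=
  card_le_card fun x hx => by
    simp only [mem_filter] at hx ⊢
    exact ⟨hx.1, h x hx.1 hx.2⟩

lemma count_or_le (h : ∀ x ∈ X, P x → Q x ∨ R x) : X.count P ≤ X.count Q + X.count R := by
  refine (card_le_card fun x hx => ?_).trans (card_union_le _ _)
  simp only [mem_filter, mem_union] at hx ⊢
  rcases h x hx.1 hx.2 with h | h
  · exact Or.inl ⟨hx.1, h⟩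
  · exact Or.inr ⟨hx.1, h⟩

lemma card_le_count_or (h : ∀ x ∈ X, Q x ∨ R x) : #X ≤ X.count Q + X.count R := by
  refine le_trans ?_ (count_or_le (P := fun _ => True) fun x hx _ => h x hx)
  simp [count]

lemma count_add_count_not : X.count P + X.count (fun x => ¬ P x) = #X := by
  unfold count
  convert card_filter_add_card_filter_not (s := X) P

lemma count_add_count_le_of_disjoint (h : ∀ x ∈ X, Q x → ¬ R x) :
    X.count Q + X.count R ≤ #X := by
  have h1 : X.count Q + X.count (fun x => ¬ Q x) = #X := count_add_count_not
  have h2 : X.count R ≤ X.count (fun x => ¬ Q x) := count_mono fun x hx hR hQ => h x hx hQ hR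
  omega

lemma count_and_add_count_and_not :
    X.count (fun x => P x ∧ Q x) + X.count (fun x => P x ∧ ¬ Q x) = X.count P := by
  simp only [count, ← filter_filter]
  exact card_filter_add_card_filter_not Q

lemma exists_of_count_lt_count (h : X.count P < X.count Q) : ∃ x ∈ X, Q x ∧ ¬ P x := by
  by_contra! hc
  exact absurd (count_mono hc) (by omega)

lemma exists_of_count_lt_card (h : X.count P < #X) : ∃ x ∈ X, ¬ P x := by
  by_contra! hc
  have : X.count P = #X := by simp [count, filter_true_of_mem hc]
  omega

lemma exists_of_count_pos (h : 0 < X.count P) : ∃ x ∈ X, P x := by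
  obtain ⟨x, hx⟩ := card_pos.1 h
  exact ⟨x, (mem_filter.1 hx).1, (mem_filter.1 hx).2⟩

lemma count_add_count_le_card_add :
    X.count P + X.count Q ≤ #X + X.count (fun x => P x ∧ Q x) := by
  have h1 := count_and_add_count_and_not (X := X) (P := P) (Q := Q)
  have h2 : X.count Q + X.count (fun x => P x ∧ ¬ Q x) ≤ #X :=
    count_add_count_le_of_disjoint fun x _ hQ h => h.2 hQ
  omega

end Finset

/-! ### Covers with few vertices per class, at large minimum degree. -/

/-- A symmetric adjacency relation `N` between `X` and `Y` in which every edge is covered by `T`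
inside a class of the labelling `ρ`, or by `S` inside a class of the labelling `σ`, where both
covers have fewer than `k` elements in each class. -/
structure LabelledCover {V ι κ : Type*} (N : V → V → Prop) (ρ : V → ι) (σ : V → κ)
    (T S : Set V) (X Y : Finset V) (n d k : ℕ) : Prop where
  symm : ∀ u v, N u v → N v u
  cov : ∀ u v, N u v → (ρ u = ρ v ∧ (u ∈ T ∨ v ∈ T)) ∨ (σ u = σ v ∧ (u ∈ S ∨ v ∈ S))
  cardX : #X = n
  cardY : #Y = n
  degX : ∀ x ∈ X, d ≤ Y.count (N x)
  degY : ∀ y ∈ Y, d ≤ X.count (N y)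
  classT : ∀ i, X.count (fun v => v ∈ T ∧ ρ v = i) + Y.count (fun v => v ∈ T ∧ ρ v = i) < k
  classS : ∀ i, X.count (fun v => v ∈ S ∧ σ v = i) + Y.count (fun v => v ∈ S ∧ σ v = i) < k
  pos : 0 < k
  two_mul_le : 2 * k ≤ n
  add_le : k + n ≤ 2 * d
  lt_three_mul : 2 * n < 3 * d

namespace LabelledCover

variable {V ι κ : Type*} {N : V → V → Prop} {ρ : V → ι} {σ : V → κ} {T S : Set V}
  {X Y : Finset V} {n d k : ℕ}

lemma swapColors (h : LabelledCover N ρ σ T S X Y n d k) : LabelledCover N σ ρ S T X Y n d k :=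
  ⟨h.symm, fun u v huv => (h.cov u v huv).symm, h.cardX, h.cardY, h.degX, h.degY, h.classS,
    h.classT, h.pos, h.two_mul_le, h.add_le, h.lt_three_mul⟩

lemma swapSides (h : LabelledCover N ρ σ T S X Y n d k) : LabelledCover N ρ σ T S Y X n d k :=
  ⟨h.symm, h.cov, h.cardY, h.cardX, h.degY, h.degX,
    fun i => by have := h.classT i; omega, fun i => by have := h.classS i; omega,
    h.pos, h.two_mul_le, h.add_le, h.lt_three_mul⟩

lemma le_count_of_adj (h : LabelledCover N ρ σ T S X Y n d k) {x : V} (hx : x ∈ X)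
    {P : V → Prop} (hP : ∀ y ∈ Y, N x y → P y) : d ≤ Y.count P :=
  (h.degX x hx).trans (count_mono hP)

lemma count_add_le_of_not_adj (h : LabelledCover N ρ σ T S X Y n d k) {x : V} (hx : x ∈ X)
    {P : V → Prop} (hP : ∀ y ∈ Y, N x y → ¬ P y) : Y.count P + d ≤ n := by
  have := h.degX x hx
  have h2 := count_add_count_le_of_disjoint (X := Y) hP
  have := h.cardY
  omega

lemma le_codegree (h : LabelledCover N ρ σ T S X Y n d k) {x x' : V} (hx : x ∈ X)
    (hx' : x' ∈ X) : k ≤ Y.count (fun y => N x y ∧ N x' y) := by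
  have h1 := h.degX x hx
  have h2 := h.degX x' hx'
  have h3 := count_add_count_le_card_add (X := Y) (P := N x) (Q := N x')
  have := h.cardY
  have := h.add_le
  omega

lemma exists_common (h : LabelledCover N ρ σ T S X Y n d k) {x x' : V} (hx : x ∈ X)
    (hx' : x' ∈ X) {P : V → Prop} (hP : Y.count P < k) : ∃ y ∈ Y, N x y ∧ N x' y ∧ ¬ P y := by
  obtain ⟨y, hy, h1, h2⟩ := exists_of_count_lt_count (hP.trans_le (h.le_codegree hx hx'))
  exact ⟨y, hy, h1.1, h1.2, h2⟩

/-- The `k` common neighbors cannot all lie in the part of `T` with this label. An edge to one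
outside it cannot be covered by `T`, so it preserves `σ`. -/
lemma label_eq_of_not_mem (h : LabelledCover N ρ σ T S X Y n d k) {x x' : V} (hx : x ∈ X)
    (hx' : x' ∈ X) (hT : x ∉ T) (hT' : x' ∉ T) (hρ : ρ x = ρ x') : σ x = σ x' := by
  obtain ⟨y, hy, h1, h2, h3⟩ := h.exists_common hx hx' (P := fun v => v ∈ T ∧ ρ v = ρ x)
    (by have := h.classT (ρ x); omega)
  have e1 := h.cov _ _ h1
  have e2 := h.cov _ _ h2
  grind

/-- If the cover `T` meets only two classes of `ρ` and is small on `Y`, there is a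
contradiction. -/
lemma false_of_two_classes_aux (h : LabelledCover N ρ σ T S X Y n d k) {i₁ i₂ : ι}
    (hX : ∀ x ∈ X, x ∈ T → ρ x = i₁ ∨ ρ x = i₂) (hY : ∀ y ∈ Y, y ∈ T → ρ y = i₁ ∨ ρ y = i₂)
    (hb : Y.count (· ∈ T) < k) : False := by
  have c1 := h.classT i₁
  have c2 := h.classT i₂
  have hk1 := h.two_mul_le
  have hk2 := h.add_le
  have hcX := h.cardX
  have hcY := h.cardY
  have a12 : X.count (· ∈ T) ≤ X.count (fun v => v ∈ T ∧ ρ v = i₁)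
      + X.count (fun v => v ∈ T ∧ ρ v = i₂) :=
    count_or_le fun x hx hT => (hX x hx hT).imp (⟨hT, ·⟩) (⟨hT, ·⟩)
  have b12 : Y.count (· ∈ T) ≤ Y.count (fun v => v ∈ T ∧ ρ v = i₁)
      + Y.count (fun v => v ∈ T ∧ ρ v = i₂) :=
    count_or_le fun x hx hT => (hY x hx hT).imp (⟨hT, ·⟩) (⟨hT, ·⟩)
  -- all of `X \ T` lies in a single class of `σ`
  obtain ⟨u₀, hu₀, hu₀T⟩ : ∃ x ∈ X, x ∉ T :=
    exists_of_count_lt_card (P := fun x => x ∈ T) (by omega)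
  obtain ⟨j, hj⟩ : ∃ j, σ u₀ = j := ⟨_, rfl⟩
  have hU : ∀ x ∈ X, x ∉ T → σ x = j := by
    intro x hx hxT
    obtain ⟨y, hy, e1, e2, hyT⟩ := h.exists_common hu₀ hx hb
    have := h.cov _ _ e1
    have := h.cov _ _ e2
    grind
  have cj := h.classS j
  -- The vertices of `Y \ T` outside the class `j` are invisible to `u₀`, and all their neighbors
  -- lie in `X ∩ T`. There are at most `n - d` of them, and if there is one, then `X ∩ T` has at
  -- least `d` elements.
  have hW'' : Y.count (fun y => y ∉ T ∧ σ y ≠ j) + d ≤ n := by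
    refine h.count_add_le_of_not_adj hu₀ fun y hy e hP => ?_
    have := h.cov _ _ e
    grind
  have hNW'' : ∀ y ∈ Y, y ∉ T → σ y ≠ j → d ≤ X.count (· ∈ T) := by
    intro y hy hyT hyj
    refine h.swapSides.le_count_of_adj hy fun x hx e => ?_
    have := h.cov _ _ e
    grind
  -- Every branch below ends by adding degree bounds until they contradict `2 * d ≥ k + n` and `n ≥
  -- 2 * k`.
  by_cases hW : ∀ y ∈ Y, y ∉ T → σ y = j → y ∈ S
  · have h1 : #Y ≤ Y.count (· ∈ T) + Y.count (fun y => ¬ y ∈ T) :=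
      card_le_count_or fun y _ => em _
    have h2 : Y.count (fun y => ¬ y ∈ T) ≤
        Y.count (fun y => y ∈ S ∧ σ y = j) + Y.count (fun y => y ∉ T ∧ σ y ≠ j) :=
      count_or_le fun y hy hyT => by have := hW y hy hyT; grind
    obtain ⟨y, hy, hyT, hyj⟩ := exists_of_count_pos
      (show 0 < Y.count (fun y => y ∉ T ∧ σ y ≠ j) by omega)
    have := hNW'' y hy hyT hyj
    omega
  push Not at hW
  obtain ⟨w, hw, hwT, hwj, hwS⟩ := hW
  have hdw : d ≤ X.count (fun v => v ∈ T ∧ ρ v = ρ w) + X.count (fun v => v ∈ S ∧ σ v = j) := by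
    refine (h.swapSides.degX w hw).trans (count_or_le fun x hx e => ?_)
    have := h.cov _ _ e
    grind
  have cw := h.classT (ρ w)
  -- the cover `T` outside the class of `w` has fewer than `k` elements
  have hout : X.count (fun v => v ∈ T ∧ ρ v ≠ ρ w) + Y.count (fun v => v ∈ T ∧ ρ v ≠ ρ w) < k := by
    have key : ∀ i i', (∀ x ∈ X, x ∈ T → ρ x = i ∨ ρ x = i') →
        (∀ y ∈ Y, y ∈ T → ρ y = i ∨ ρ y = i') → ρ w = i →
        X.count (fun v => v ∈ T ∧ ρ v ≠ ρ w) + Y.count (fun v => v ∈ T ∧ ρ v ≠ ρ w) < k := by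
      intro i i' hX hY hi
      have h1 : X.count (fun v => v ∈ T ∧ ρ v ≠ ρ w) ≤ X.count (fun v => v ∈ T ∧ ρ v = i') :=
        count_mono fun x hx hxT => by have := hX x hx; grind
      have h2 : Y.count (fun v => v ∈ T ∧ ρ v ≠ ρ w) ≤ Y.count (fun v => v ∈ T ∧ ρ v = i') :=
        count_mono fun x hx hxT => by have := hY x hx; grind
      have := h.classT i'
      omega
    by_cases hw1 : ρ w = i₁
    · exact key i₁ i₂ hX hY hw1
    by_cases hw2 : ρ w = i₂
    · exact key i₂ i₁ (fun x hx hT => (hX x hx hT).symm) (fun x hx hT => (hY x hx hT).symm) hw2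
    have h0 : X.count (fun v => v ∈ T ∧ ρ v = ρ w) ≤ X.count (fun _ => False) :=
      count_mono fun x hx hxT => by have := hX x hx; grind
    have h00 : X.count (fun _ => False) = 0 := by simp [Finset.count]
    omega
  have eX := count_and_add_count_and_not (X := X) (P := (· ∈ T)) (Q := fun v => ρ v = ρ w)
  have eY := count_and_add_count_and_not (X := Y) (P := (· ∈ T)) (Q := fun v => ρ v = ρ w)
  by_cases hUS : ∃ u ∈ X, u ∉ T ∧ u ∉ S
  · obtain ⟨u, hu, huT, huS⟩ := hUS
    have h1 : d ≤ Y.count (· ∈ T) + Y.count (fun y => y ∈ S ∧ σ y = j) := by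
      refine (h.degX u hu).trans (count_or_le fun y hy e => ?_)
      have := h.cov _ _ e
      grind
    omega
  push Not at hUS
  have hWρ : ∀ y ∈ Y, y ∉ T → σ y = j → y ∉ S → ρ y = ρ w := by
    intro y hy hyT hyj hyS
    by_contra hne
    obtain ⟨x, hx, e1, e2, hxP⟩ := h.swapSides.exists_common hw hy
      (P := fun v => v ∈ S ∧ σ v = j) (by omega)
    have := h.cov _ _ e1
    have := h.cov _ _ e2
    grind
  -- This `x` has no neighbor in the class `j` outside `T` and `S`: by `hWρ` such a vertex has the
  -- label `ρ w`, and the pair is not covered by `S` either.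
  obtain ⟨x, hx, hxT, hxρ, hxS⟩ : ∃ x ∈ X, x ∈ T ∧ ρ x ≠ ρ w ∧ ¬ (x ∈ S ∧ σ x = j) := by
    by_contra! hc
    have : #X ≤ X.count (fun v => v ∈ T ∧ ρ v = ρ w) + X.count (fun v => v ∈ S ∧ σ v = j) :=
      card_le_count_or fun x hx => by
        have := hc x hx
        have := hU x hx
        have := hUS x hx
        grind
    omega
  have hdx : d ≤ Y.count (· ∈ T) + Y.count (fun y => (y ∈ S ∧ σ y = j) ∨ (y ∉ T ∧ σ y ≠ j)) := by
    refine (h.degX x hx).trans (count_or_le fun y hy e => ?_)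
    have := h.cov _ _ e
    have := hWρ y hy
    grind
  have hdx2 : Y.count (fun y => (y ∈ S ∧ σ y = j) ∨ (y ∉ T ∧ σ y ≠ j)) ≤
      Y.count (fun y => y ∈ S ∧ σ y = j) + Y.count (fun y => y ∉ T ∧ σ y ≠ j) :=
    count_or_le fun y hy e => e
  rcases Nat.eq_zero_or_pos (Y.count (fun y => y ∉ T ∧ σ y ≠ j)) with h0 | hpos
  · omega
  · obtain ⟨y, hy, hyT, hyj⟩ := exists_of_count_pos hpos
    have := hNW'' y hy hyT hyj
    omega

/-- The cover `T` meets at least three classes of `ρ`. -/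
lemma exists_third_class (h : LabelledCover N ρ σ T S X Y n d k) (i₁ i₂ : ι) :
    ∃ v, (v ∈ X ∨ v ∈ Y) ∧ v ∈ T ∧ ρ v ≠ i₁ ∧ ρ v ≠ i₂ := by
  by_contra! hc
  have hX : ∀ x ∈ X, x ∈ T → ρ x = i₁ ∨ ρ x = i₂ := fun x hx hT => by
    have := hc x (Or.inl hx) hT; tauto
  have hY : ∀ x ∈ Y, x ∈ T → ρ x = i₁ ∨ ρ x = i₂ := fun x hx hT => by
    have := hc x (Or.inr hx) hT; tauto
  have c1 := h.classT i₁
  have c2 := h.classT i₂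
  have a12 : X.count (· ∈ T) ≤ X.count (fun v => v ∈ T ∧ ρ v = i₁)
      + X.count (fun v => v ∈ T ∧ ρ v = i₂) :=
    count_or_le fun x hx hT => (hX x hx hT).imp (⟨hT, ·⟩) (⟨hT, ·⟩)
  have b12 : Y.count (· ∈ T) ≤ Y.count (fun v => v ∈ T ∧ ρ v = i₁)
      + Y.count (fun v => v ∈ T ∧ ρ v = i₂) :=
    count_or_le fun x hx hT => (hY x hx hT).imp (⟨hT, ·⟩) (⟨hT, ·⟩)
  -- Two classes hold fewer than `2 * k` elements of `T`, so one side holds fewer than `k`.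
  by_cases hb : Y.count (· ∈ T) < k
  · exact h.false_of_two_classes_aux hX hY hb
  · exact h.swapSides.false_of_two_classes_aux hY hX (by omega)

/-- No three vertices of `X` lie in pairwise different classes of both labellings. -/
lemma not_three_different (h : LabelledCover N ρ σ T S X Y n d k) {x₁ x₂ x₃ : V}
    (h₁ : x₁ ∈ X) (h₂ : x₂ ∈ X) (h₃ : x₃ ∈ X) (r₁₂ : ρ x₁ ≠ ρ x₂) (r₁₃ : ρ x₁ ≠ ρ x₃)
    (r₂₃ : ρ x₂ ≠ ρ x₃) (s₁₂ : σ x₁ ≠ σ x₂) (s₁₃ : σ x₁ ≠ σ x₃) (s₂₃ : σ x₂ ≠ σ x₃) : False := by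
  have d1 := h.degX x₁ h₁
  have d2 := h.degX x₂ h₂
  have d3 := h.degX x₃ h₃
  have e1 := count_add_count_le_card_add (X := Y) (P := N x₁) (Q := N x₂)
  -- A vertex shares its `ρ` label with at most one of the three and its `σ` label with at most one,
  -- so it is adjacent to at most two of them.
  have e2 : Y.count (N x₃) + Y.count (fun y => N x₁ y ∧ N x₂ y) ≤ #Y := by
    refine count_add_count_le_of_disjoint fun y hy f3 f => ?_
    have := h.cov _ _ f3
    have := h.cov _ _ f.1
    have := h.cov _ _ f.2
    grind
  have := h.cardY
  have := h.lt_three_mul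
  omega

/-- Regard each `x` as an edge joining `ρ x` to `σ x`. By `h3` there is no matching of three edges,
so by Kőnig two labels cover everything; `hρ` and `hσ` exclude two labels of the same kind. The
proof is a direct case analysis. -/
lemma exists_two_class_cover {X : Finset V}
    (h3 : ∀ x₁ ∈ X, ∀ x₂ ∈ X, ∀ x₃ ∈ X, ρ x₁ ≠ ρ x₂ → ρ x₁ ≠ ρ x₃ → ρ x₂ ≠ ρ x₃ →
      σ x₁ ≠ σ x₂ → σ x₁ ≠ σ x₃ → σ x₂ ≠ σ x₃ → False)
    (hρ : ∀ i₁ i₂, ∃ x ∈ X, ρ x ≠ i₁ ∧ ρ x ≠ i₂) (hσ : ∀ j₁ j₂, ∃ x ∈ X, σ x ≠ j₁ ∧ σ x ≠ j₂)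
    {x₀ : V} (hx₀ : x₀ ∈ X) : ∃ i j, ∀ x ∈ X, ρ x = i ∨ σ x = j := by
  by_contra! hc
  obtain ⟨x₁, hx₁, r₁, s₁⟩ := hc (ρ x₀) (σ x₀)
  obtain ⟨x₂, hx₂, r₂, r₂'⟩ := hρ (ρ x₀) (ρ x₁)
  obtain ⟨x₃, hx₃, s₃, s₃'⟩ := hσ (σ x₀) (σ x₁)
  have key : ∀ u ∈ X, ∀ v ∈ X, ρ u ≠ ρ v → σ u ≠ σ v → ρ x₂ ≠ ρ u → ρ x₂ ≠ ρ v →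
      σ x₃ ≠ σ u → σ x₃ ≠ σ v → σ x₂ = σ u → False := by
    -- Here `u` and `v` are `x₀` and `x₁` in either order. The label `σ x₂` must agree with one of
    -- theirs, since otherwise `x₀`, `x₁`, `x₂` are pairwise different in both labels.
    intro u hu v hv n1 n2 n3 n4 n5 n6 n7
    obtain ⟨x, hx, m1, m2⟩ := hc (ρ v) (σ u)
    have a1 := h3 x₃ hx₃ u hu v hv
    have a2 := h3 v hv x₂ hx₂ x₃ hx₃
    have a3 := h3 x hx u hu v hv
    have a4 := h3 x hx x₃ hx₃ u hu
    have a5 := h3 x hx x₂ hx₂ v hv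
    have a6 := h3 x hx x₂ hx₂ x₃ hx₃
    clear h3 hc hρ hσ
    by_cases ρ x = ρ x₂ <;> by_cases σ x = σ x₃ <;> by_cases ρ x₃ = ρ u <;>
      by_cases ρ x₃ = ρ v <;> grind
  have b1 := key x₀ hx₀ x₁ hx₁
  have b2 := key x₁ hx₁ x₀ hx₀
  have b3 := h3 x₀ hx₀ x₁ hx₁ x₂ hx₂
  clear h3 hc hρ hσ key
  grind

/-- If every vertex of `X` lies in a fixed class of `ρ` or a fixed class of `σ`, there is a
contradiction. -/
lemma false_of_mixed_classes (h : LabelledCover N ρ σ T S X Y n d k) {i : ι} {j : κ}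
    (hX : ∀ x ∈ X, ρ x = i ∨ σ x = j) (hρ : ∀ i', ∃ x ∈ X, ρ x ≠ i ∧ ρ x ≠ i')
    (hσ : ∀ j', ∃ x ∈ X, σ x ≠ j ∧ σ x ≠ j') : False := by
  obtain ⟨x₂, hx₂, r₂, -⟩ := hρ i
  obtain ⟨x₃, hx₃, r₃, r₂₃⟩ := hρ (ρ x₂)
  obtain ⟨z₂, hz₂, s₂, -⟩ := hσ j
  obtain ⟨z₃, hz₃, s₃, s₂₃⟩ := hσ (σ z₂)
  have cT := h.classT i
  have cS := h.classS j
  have hcX := h.cardX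
  have hcY := h.cardY
  have hk1 := h.two_mul_le
  have hk2 := h.add_le
  -- Otherwise `x₂`, `z₂` have a common neighbor labelled `(ρ x₂, σ z₂)`, and `x₃`, `z₃` one
  -- labelled `(ρ x₃, σ z₃)`. A common neighbor of these two would have neither `ρ`-label `i` nor
  -- `σ`-label `j`.
  have hYk : k ≤ Y.count (fun y => ρ y = i ∧ σ y = j) := by
    by_contra! hlt
    obtain ⟨y, hy, e1, e2, hyP⟩ := h.exists_common hx₂ hz₂ hlt
    obtain ⟨y', hy', e1', e2', hyP'⟩ := h.exists_common hx₃ hz₃ hlt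
    obtain ⟨x, hx, f, f', -⟩ := h.swapSides.exists_common hy hy' (P := fun _ => False)
      (by simp [Finset.count]; omega)
    have := hX x hx
    have := hX _ hx₂
    have := hX _ hx₃
    have := hX _ hz₂
    have := hX _ hz₃
    have := h.cov _ _ e1
    have := h.cov _ _ e2
    have := h.cov _ _ e1'
    have := h.cov _ _ e2'
    have := h.cov _ _ f
    have := h.cov _ _ f'
    grind
  by_cases hfree : ∃ x ∈ X, ρ x = i ∧ σ x = j ∧ x ∉ T ∧ x ∉ S
  · obtain ⟨x, hx, xi, xj, xT, xS⟩ := hfree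
    have hd : d ≤ Y.count (fun v => v ∈ T ∧ ρ v = i) + Y.count (fun v => v ∈ S ∧ σ v = j) := by
      refine (h.degX x hx).trans (count_or_le fun y hy e => ?_)
      have := h.cov _ _ e
      grind
    have : #Y ≤ Y.count (fun v => v ∈ T ∧ ρ v = i) + Y.count (fun v => v ∈ S ∧ σ v = j) := by
      refine card_le_count_or fun y hy => ?_
      by_contra hcon
      have : d ≤ X.count (fun v => v ∈ T ∧ ρ v = i) + X.count (fun v => v ∈ S ∧ σ v = j) := by
        refine (h.degY y hy).trans (count_or_le fun x' hx' e => ?_)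
        have c1 := h.cov _ _ e
        have c2 := hX x' hx'
        have c3 := h.label_eq_of_not_mem hx hx' xT
        have c4 := h.swapColors.label_eq_of_not_mem hx hx' xS
        grind
      omega
    omega
  push Not at hfree
  -- the vertices of `X` outside both covers lie in exactly one of the two classes
  have hsplit : #X ≤ X.count (fun v => (v ∈ T ∧ ρ v = i) ∨ (v ∈ S ∧ σ v = j)) +
      X.count (fun v => (v ∉ T ∧ ρ v = i ∧ σ v ≠ j) ∨ (v ∉ S ∧ σ v = j ∧ ρ v ≠ i)) := by
    refine card_le_count_or fun x hx => ?_
    have := hfree x hx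
    have := hX x hx
    grind
  have hs1 : X.count (fun v => (v ∈ T ∧ ρ v = i) ∨ (v ∈ S ∧ σ v = j)) ≤
    X.count (fun v => v ∈ T ∧ ρ v = i) + X.count (fun v => v ∈ S ∧ σ v = j) :=
    count_or_le fun x _ hx => hx
  have hs2 : X.count (fun v => (v ∉ T ∧ ρ v = i ∧ σ v ≠ j) ∨ (v ∉ S ∧ σ v = j ∧ ρ v ≠ i)) ≤
    X.count (fun v => v ∉ T ∧ ρ v = i ∧ σ v ≠ j) + X.count (fun v => v ∉ S ∧ σ v = j ∧ ρ v ≠ i) :=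
    count_or_le fun x _ hx => hx
  by_cases hfreeY : ∃ y ∈ Y, ρ y = i ∧ σ y = j ∧ y ∉ T ∧ y ∉ S
  · obtain ⟨y₀, hy₀, yi, yj, yT, yS⟩ := hfreeY
    have hd : d ≤ X.count (fun v => v ∈ T ∧ ρ v = i) + X.count (fun v => v ∈ S ∧ σ v = j) := by
      refine (h.degY y₀ hy₀).trans (count_or_le fun x hx e => ?_)
      have := h.cov _ _ e
      grind
    obtain ⟨x, hx, hxP⟩ := exists_of_count_pos
      (show 0 < X.count (fun v => (v ∉ T ∧ ρ v = i ∧ σ v ≠ j) ∨ (v ∉ S ∧ σ v = j ∧ ρ v ≠ i)) by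
        omega)
    rcases hxP with ⟨xT, xi, xj⟩ | ⟨xS, xj, xi⟩
    · have h1 : d ≤ Y.count (fun v => v ∈ T ∧ ρ v = i) +
          Y.count (fun v => ρ v ≠ i ∧ σ v = σ x) := by
        refine (h.degX x hx).trans (count_or_le fun y hy e => ?_)
        have := h.cov _ _ e
        have := h.swapSides.label_eq_of_not_mem hy₀ hy yT
        grind
      -- Since `σ z ≠ j`, the vertex `z` has `ρ`-label `i`, so it sees no vertex with another
      -- `ρ`-label and `σ`-label `σ x`. Hence these are at most `n - d`, and `2 * d < k + n`.
      obtain ⟨z, hz, zj, zx⟩ := hσ (σ x)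
      have h2 : Y.count (fun v => ρ v ≠ i ∧ σ v = σ x) + d ≤ n := by
        refine h.count_add_le_of_not_adj hz fun y hy e => ?_
        have := h.cov _ _ e
        have := hX z hz
        grind
      omega
    · have h1 : d ≤ Y.count (fun v => v ∈ S ∧ σ v = j) +
          Y.count (fun v => σ v ≠ j ∧ ρ v = ρ x) := by
        refine (h.degX x hx).trans (count_or_le fun y hy e => ?_)
        have := h.cov _ _ e
        have := h.swapSides.swapColors.label_eq_of_not_mem hy₀ hy yS
        grind
      obtain ⟨z, hz, zi, zx⟩ := hρ (ρ x)
      have h2 : Y.count (fun v => σ v ≠ j ∧ ρ v = ρ x) + d ≤ n := by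
        refine h.count_add_le_of_not_adj hz fun y hy e => ?_
        have := h.cov _ _ e
        have := hX z hz
        grind
      omega
  · push Not at hfreeY
    have h1 : Y.count (fun y => ρ y = i ∧ σ y = j) ≤
        Y.count (fun v => v ∈ T ∧ ρ v = i) + Y.count (fun v => v ∈ S ∧ σ v = j) :=
      count_or_le fun y hy e => by have := hfreeY y hy; grind
    -- Both vertices are labelled `(i, j)`, one outside `T` and one outside `S`. Each misses one of
    -- the two sets of uncovered vertices of `X` lying in exactly one class, so each of these sets
    -- has at most `n - d` elements.
    obtain ⟨y₁, hy₁, ⟨y₁i, y₁j⟩, y₁T⟩ := exists_of_count_lt_count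
      (show Y.count (fun v => v ∈ T ∧ ρ v = i) < Y.count (fun y => ρ y = i ∧ σ y = j) by omega)
    obtain ⟨y₂, hy₂, ⟨y₂i, y₂j⟩, y₂S⟩ := exists_of_count_lt_count
      (show Y.count (fun v => v ∈ S ∧ σ v = j) < Y.count (fun y => ρ y = i ∧ σ y = j) by omega)
    have h3 : X.count (fun v => v ∉ T ∧ ρ v = i ∧ σ v ≠ j) + d ≤ n := by
      refine h.swapSides.count_add_le_of_not_adj hy₁ fun x hx e => ?_
      have := h.cov _ _ e
      grind
    have h4 : X.count (fun v => v ∉ S ∧ σ v = j ∧ ρ v ≠ i) + d ≤ n := by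
      refine h.swapSides.count_add_le_of_not_adj hy₂ fun x hx e => ?_
      have := h.cov _ _ e
      grind
    omega

/-- The hypotheses `hT` and `hS` transfer the third class of each cover to a vertex of `X`, so that
no two labels of one kind exhaust `X`. -/
theorem false_of_attained (h : LabelledCover N ρ σ T S X Y n d k)
    (hT : ∀ v, v ∈ T → ∃ x ∈ X, ρ x = ρ v) (hS : ∀ v, v ∈ S → ∃ x ∈ X, σ x = σ v) : False := by
  have hρ : ∀ i₁ i₂, ∃ x ∈ X, ρ x ≠ i₁ ∧ ρ x ≠ i₂ := by
    intro i₁ i₂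
    obtain ⟨v, -, hv, h1, h2⟩ := h.exists_third_class i₁ i₂
    obtain ⟨x, hx, e⟩ := hT v hv
    exact ⟨x, hx, e ▸ h1, e ▸ h2⟩
  have hσ : ∀ i₁ i₂, ∃ x ∈ X, σ x ≠ i₁ ∧ σ x ≠ i₂ := by
    intro i₁ i₂
    obtain ⟨v, -, hv, h1, h2⟩ := h.swapColors.exists_third_class i₁ i₂
    obtain ⟨x, hx, e⟩ := hS v hv
    exact ⟨x, hx, e ▸ h1, e ▸ h2⟩
  have hn : 0 < #X := by
    have := h.cardX; have := h.pos; have := h.two_mul_le; omega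
  obtain ⟨x₀, hx₀⟩ := card_pos.1 hn
  obtain ⟨i, j, hij⟩ := exists_two_class_cover
    (fun x₁ h₁ x₂ h₂ x₃ h₃ => h.not_three_different h₁ h₂ h₃)
    hρ hσ hx₀
  exact h.false_of_mixed_classes hij (hρ i) (hσ j)

end LabelledCover

end Counting

/-! ### Monochromatic connected matchings from Kőnig's theorem. -/

section ConnectedMatching

open Finset
open scoped Classical

lemma Finset.card_eq_sum_count {V ι : Type*} {X : Finset V} {I : Finset ι} {ρ : V → ι}
    (h : ∀ x ∈ X, ρ x ∈ I) : #X = ∑ i ∈ I, X.count (fun v => ρ v = i) := by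
  unfold Finset.count
  exact card_eq_sum_card_fiberwise h

lemma Finset.count_eq_sum_count {V ι : Type*} {X : Finset V} {I : Finset ι} {ρ : V → ι}
    (P : V → Prop) (h : ∀ x ∈ X, ρ x ∈ I) :
    X.count P = ∑ i ∈ I, X.count (fun v => P v ∧ ρ v = i) := by
  have : ∀ x ∈ X.filter P, ρ x ∈ I := fun x hx => h x (mem_filter.1 hx).1
  have h2 := card_eq_sum_count this
  unfold Finset.count at *
  rw [h2]
  simp only [filter_filter]

/-- If every edge is covered inside a class of `ρ` by `T` or inside a class of `σ` by `S`, and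
these covers are no larger than either side of each class, then some class of one of the covers
has more than half the minimum degree many elements. -/
lemma false_of_small_covers {V ι κ : Type*} {N : V → V → Prop} {ρ : V → ι} {σ : V → κ}
    {T S : Set V} {X Y : Finset V} {d k : ℕ}
    (cov : ∀ u v, N u v → (ρ u = ρ v ∧ (u ∈ T ∨ v ∈ T)) ∨ (σ u = σ v ∧ (u ∈ S ∨ v ∈ S)))
    (hX : X.Nonempty) (degX : ∀ x ∈ X, d ≤ Y.count (N x)) (degY : ∀ y ∈ Y, d ≤ X.count (N y))
    (classT : ∀ i, X.count (fun v => v ∈ T ∧ ρ v = i) + Y.count (fun v => v ∈ T ∧ ρ v = i) < k)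
    (classS : ∀ i, X.count (fun v => v ∈ S ∧ σ v = i) + Y.count (fun v => v ∈ S ∧ σ v = i) < k)
    (TX : ∀ i, X.count (fun v => v ∈ T ∧ ρ v = i) + Y.count (fun v => v ∈ T ∧ ρ v = i) ≤
      X.count (fun v => ρ v = i))
    (TY : ∀ i, X.count (fun v => v ∈ T ∧ ρ v = i) + Y.count (fun v => v ∈ T ∧ ρ v = i) ≤
      Y.count (fun v => ρ v = i))
    (SX : ∀ i, X.count (fun v => v ∈ S ∧ σ v = i) + Y.count (fun v => v ∈ S ∧ σ v = i) ≤
      X.count (fun v => σ v = i))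
    (SY : ∀ i, X.count (fun v => v ∈ S ∧ σ v = i) + Y.count (fun v => v ∈ S ∧ σ v = i) ≤
      Y.count (fun v => σ v = i))
    (hk : 2 * k ≤ d) : False := by
  obtain ⟨x₀, hx₀⟩ := hX
  have free : ∀ X Y : Finset V, (∀ x ∈ X, d ≤ Y.count (N x)) →
      (∀ i, Y.count (fun v => v ∈ T ∧ ρ v = i) < k) →
      (∀ i, Y.count (fun v => v ∈ S ∧ σ v = i) < k) → ∀ x ∈ X, x ∈ T ∨ x ∈ S := by
    intro X Y deg cT cS x hx
    by_contra hc
    have : d ≤ Y.count (fun v => v ∈ T ∧ ρ v = ρ x) + Y.count (fun v => v ∈ S ∧ σ v = σ x) := by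
      refine (deg x hx).trans (count_or_le fun y hy e => ?_)
      have := cov _ _ e
      grind
    have := cT (ρ x)
    have := cS (σ x)
    omega
  have hfX : #X ≤ X.count (fun v => v ∈ T) + X.count (fun v => v ∈ S) :=
    card_le_count_or (free X Y degX (fun i => by have := classT i; omega)
    (fun i => by have := classS i; omega))
  have hfY : #Y ≤ Y.count (fun v => v ∈ T) + Y.count (fun v => v ∈ S) :=
    card_le_count_or (free Y X degY (fun i => by have := classT i; omega)
    (fun i => by have := classS i; omega))
  obtain ⟨I, hIX, hIY⟩ : ∃ I : Finset ι, (∀ x ∈ X, ρ x ∈ I) ∧ ∀ y ∈ Y, ρ y ∈ I :=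
    ⟨(X ∪ Y).image ρ, fun x hx => mem_image_of_mem _ (mem_union_left _ hx),
      fun x hx => mem_image_of_mem _ (mem_union_right _ hx)⟩
  obtain ⟨J, hJX, hJY⟩ : ∃ J : Finset κ, (∀ x ∈ X, σ x ∈ J) ∧ ∀ y ∈ Y, σ y ∈ J :=
    ⟨(X ∪ Y).image σ, fun x hx => mem_image_of_mem _ (mem_union_left _ hx),
      fun x hx => mem_image_of_mem _ (mem_union_right _ hx)⟩
  have e1 := count_eq_sum_count (fun v => v ∈ T) hIX
  have e2 := count_eq_sum_count (fun v => v ∈ T) hIY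
  have e3 := count_eq_sum_count (fun v => v ∈ S) hJX
  have e4 := count_eq_sum_count (fun v => v ∈ S) hJY
  have f1 := sum_le_sum fun i (_ : i ∈ I) => TX i
  have f2 := sum_le_sum fun i (_ : i ∈ I) => TY i
  have f3 := sum_le_sum fun i (_ : i ∈ J) => SX i
  have f4 := sum_le_sum fun i (_ : i ∈ J) => SY i
  -- `T` and `S` together have at least `#X + #Y` elements, while each has at most `min #X #Y`. So
  -- equality holds in every class: the classes of `x₀` have fewer than `k` vertices in `Y`, and
  -- `x₀` has fewer than `2 * k` neighbors.
  have g2 := (sum_eq_sum_iff_of_le fun i (_ : i ∈ I) => TY i).1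
  have g4 := (sum_eq_sum_iff_of_le fun i (_ : i ∈ J) => SY i).1
  simp only [sum_add_distrib, ← e1, ← e2, ← e3, ← e4, ← card_eq_sum_count hIX,
    ← card_eq_sum_count hIY, ← card_eq_sum_count hJX, ← card_eq_sum_count hJY] at f1 f2 f3 f4 g2 g4
  have h2 := g2 (by omega) (ρ x₀) (hIX _ hx₀)
  have h4 := g4 (by omega) (σ x₀) (hJX _ hx₀)
  have hd : d ≤ Y.count (fun v => ρ v = ρ x₀) + Y.count (fun v => σ v = σ x₀) := by
    refine (degX x₀ hx₀).trans (count_or_le fun y hy e => ?_)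
    have := cov _ _ e
    grind
  have := classT (ρ x₀)
  have := classS (σ x₀)
  omega

/-- **Kőnig's theorem**: a bipartite relation has a vertex cover and a matching of the same
size. -/
theorem exists_cover_and_matching {V : Type*} (r : V → V → Prop) (X Y : Finset V) :
    ∃ A ⊆ X, ∃ B ⊆ Y, (∀ x ∈ X, ∀ y ∈ Y, r x y → x ∈ A ∨ y ∈ B) ∧
      ∃ M ⊆ X, ∃ f : V → V, Set.InjOn f M ∧ (∀ x ∈ M, f x ∈ Y ∧ r x (f x)) ∧
        #M = #A + #B := by
  let nb : Finset V → Finset V := fun A => {y ∈ Y | ∃ x ∈ A, r x y}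
  -- This is Hall's theorem with defect: `D` is the largest value of `#A - #(nb A)`. After `D` dummy
  -- partners are added, Hall's condition holds, and at most `D` vertices use a dummy. The cover is
  -- `X \ A₀` together with `nb A₀`.
  obtain ⟨A₀, hA₀, hmax⟩ := exists_max_image X.powerset (fun A => (#A : ℤ) - #(nb A))
    ⟨∅, by simp⟩
  rw [mem_powerset] at hA₀
  have h0 : (0 : ℤ) ≤ #A₀ - #(nb A₀) := by
    have := hmax ∅ (by simp)
    simpa [nb] using this
  obtain ⟨D, hD⟩ := Int.eq_ofNat_of_zero_le h0
  have hall : ∃ f : {x // x ∈ X} → V ⊕ Fin D, Function.Injective f ∧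
      ∀ x, f x ∈ disjSum (nb {x.1}) (univ : Finset (Fin D)) := by
    refine (all_card_le_biUnion_card_iff_exists_injective _).1 fun s => ?_
    rcases s.eq_empty_or_nonempty with rfl | ⟨x₀, hx₀⟩
    · simp
    have hs := hmax (s.map (Function.Embedding.subtype _)) (by
      rw [mem_powerset]; intro x hx; simp at hx; exact hx.1)
    have hsub : disjSum (nb (s.map (Function.Embedding.subtype _))) (univ : Finset (Fin D)) ⊆
        s.biUnion fun x => disjSum (nb {x.1}) (univ : Finset (Fin D)) := by
      intro z hz
      rw [mem_biUnion]
      rcases z with y | i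
      · simp only [inl_mem_disjSum, nb, mem_filter, mem_map, Function.Embedding.subtype_apply] at hz
        obtain ⟨hy, x, ⟨x', hx', rfl⟩, hr⟩ := hz
        exact ⟨x', hx', by simp [nb, hy, hr]⟩
      · exact ⟨x₀, hx₀, by simp⟩
    have := card_le_card hsub
    rw [card_disjSum, card_fin] at this
    simp only [card_map] at hs
    omega
  obtain ⟨f, hf, hfm⟩ := hall
  let M : Finset {x // x ∈ X} := {x | (f x).isLeft}
  have hM : #X ≤ #M + D := by
    have h1 := card_filter_add_card_filter_not (s := (univ : Finset {x // x ∈ X}))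
      (fun x => (f x).isLeft = true)
    have h2 : #({x : {x // x ∈ X} | ¬ (f x).isLeft = true}) ≤
        #((univ : Finset (Fin D)).map Function.Embedding.inr : Finset (V ⊕ Fin D)) := by
      refine card_le_card_of_injOn f (fun x hx => ?_) hf.injOn
      simp only [coe_filter, mem_univ, true_and, Set.mem_ofPred_eq] at hx
      rcases hfx : f x with y | i
      · simp [hfx] at hx
      · simp
    rw [card_map, card_fin] at h2
    rw [card_univ, Fintype.card_coe] at h1
    change #M + _ = _ at h1
    omega
  let g : V → V := fun x => if h : x ∈ X then (f ⟨x, h⟩).elim id (fun _ => x) else x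
  obtain ⟨M', hM', hcM'⟩ : ∃ M' ⊆ M.map (Function.Embedding.subtype _),
      #M' = #(X \ A₀) + #(nb A₀) := by
    refine exists_subset_card_eq ?_
    rw [card_map, card_sdiff_of_subset hA₀]
    have := card_le_card hA₀
    omega
  have hgM : ∀ x ∈ M', ∃ h : x ∈ X, f ⟨x, h⟩ = Sum.inl (g x) := by
    intro x hx
    have := hM' hx
    simp only [mem_map, Function.Embedding.subtype_apply, M, mem_filter, mem_univ, true_and] at this
    obtain ⟨⟨x', h⟩, hl, rfl⟩ := this
    refine ⟨h, ?_⟩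
    rcases hfx : f ⟨x', h⟩ with y | i
    · simp [g, h, hfx]
    · simp [hfx] at hl
  refine ⟨X \ A₀, sdiff_subset, nb A₀, filter_subset _ _, ?_, M', ?_, g, ?_, ?_, hcM'⟩
  · intro x hx y hy hr
    by_cases hxA : x ∈ A₀
    · exact Or.inr (by simp only [nb, mem_filter]; exact ⟨hy, x, hxA, hr⟩)
    · exact Or.inl (by simp [hx, hxA])
  · exact fun x hx => (hgM x hx).1
  · intro x hx x' hx' e
    obtain ⟨h1, h2⟩ := hgM x hx
    obtain ⟨h1', h2'⟩ := hgM x' hx'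
    have := hf (h2.trans (e ▸ h2'.symm))
    exact congrArg Subtype.val this
  · intro x hx
    obtain ⟨h1, h2⟩ := hgM x hx
    have := hfm ⟨x, h1⟩
    rw [h2] at this
    simpa [nb] using this

/-- `H` has a matching of size `k` from `X` to `Y` inside one of its connected components. -/
def SimpleGraph.HasConnectedMatching {V : Type*} (H : SimpleGraph V) (X Y : Finset V) (k : ℕ) :
    Prop :=
  ∃ f g : Fin k → V, Function.Injective f ∧ Function.Injective g ∧ (∀ l, f l ∈ X) ∧
    (∀ l, g l ∈ Y) ∧ (∀ l, H.Adj (f l) (g l)) ∧ ∀ l l', H.Reachable (f l) (f l')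

/-- If `H` has no connected matching of size `k`, then its edges are covered by a set that has
fewer than `k` elements in each component. -/
lemma SimpleGraph.exists_cover_of_not_hasConnectedMatching {V : Type*} {H : SimpleGraph V}
    {X Y : Finset V} {k : ℕ} (hXY : Disjoint X Y)
    (hH : ∀ u v, H.Adj u v → (u ∈ X ∧ v ∈ Y) ∨ (u ∈ Y ∧ v ∈ X))
    (hno : ¬ H.HasConnectedMatching X Y k) :
    ∃ T : Set V, (∀ u v, H.Adj u v → u ∈ T ∨ v ∈ T) ∧
      ∀ c : H.ConnectedComponent,
      (X.count (fun v => v ∈ T ∧ H.connectedComponentMk v = c) +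
        Y.count (fun v => v ∈ T ∧ H.connectedComponentMk v = c) < k) ∧
      (X.count (fun v => v ∈ T ∧ H.connectedComponentMk v = c) +
        Y.count (fun v => v ∈ T ∧ H.connectedComponentMk v = c) ≤
          X.count (fun v => H.connectedComponentMk v = c)) ∧
      (X.count (fun v => v ∈ T ∧ H.connectedComponentMk v = c) +
        Y.count (fun v => v ∈ T ∧ H.connectedComponentMk v = c) ≤
          Y.count (fun v => H.connectedComponentMk v = c)) ∧
      ∀ v, v ∈ T → ∃ x ∈ X, H.connectedComponentMk x = H.connectedComponentMk v := by
  choose A hA B hB hcov M hM f hf hfM hcard using fun c : H.ConnectedComponent =>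
    exists_cover_and_matching H.Adj {x ∈ X | H.connectedComponentMk x = c}
      {y ∈ Y | H.connectedComponentMk y = c}
  have hlt : ∀ c, #(A c) + #(B c) < k := by
    intro c
    by_contra! hk
    rw [← hcard] at hk
    obtain ⟨M', hM', hM'k⟩ := exists_subset_card_eq hk
    have hmem : ∀ l, ((M'.equivFinOfCardEq hM'k).symm l : V) ∈ M c := fun l =>
      hM' ((M'.equivFinOfCardEq hM'k).symm l).2
    refine hno ⟨fun l => (M'.equivFinOfCardEq hM'k).symm l,
      fun l => f c ((M'.equivFinOfCardEq hM'k).symm l), ?_, ?_, ?_, ?_, ?_, ?_⟩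
    · exact Subtype.val_injective.comp (Equiv.injective _)
    · intro l l' e
      exact (Equiv.injective _) (Subtype.val_injective (hf c (hmem l) (hmem l') e))
    · exact fun l => (mem_filter.1 (hM c (hmem l))).1
    · exact fun l => (mem_filter.1 (hfM c _ (hmem l)).1).1
    · exact fun l => (hfM c _ (hmem l)).2
    · intro l l'
      refine SimpleGraph.ConnectedComponent.exact ?_
      rw [(mem_filter.1 (hM c (hmem l))).2, (mem_filter.1 (hM c (hmem l'))).2]
  have hleX : ∀ c, #(A c) + #(B c) ≤ X.count (fun v => H.connectedComponentMk v = c) :=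
    fun c => (hcard c).symm.le.trans (card_le_card (hM c))
  have hleY : ∀ c, #(A c) + #(B c) ≤ Y.count (fun v => H.connectedComponentMk v = c) := by
    intro c
    rw [← hcard]
    exact card_le_card_of_injOn (f c) (fun x hx => (hfM c x hx).1) (hf c)
  let T : Set V := {v | v ∈ A (H.connectedComponentMk v) ∨ v ∈ B (H.connectedComponentMk v)}
  have hTX : ∀ c, X.count (fun v => v ∈ T ∧ H.connectedComponentMk v = c) ≤ #(A c) := by
    refine fun c => card_le_card fun v hv => ?_
    simp only [mem_filter] at hv
    obtain ⟨hvX, hvT, rfl⟩ := hv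
    rcases hvT with h | h
    · exact h
    · exact absurd (mem_filter.1 (hB _ h)).1 (Finset.disjoint_left.1 hXY hvX)
  have hTY : ∀ c, Y.count (fun v => v ∈ T ∧ H.connectedComponentMk v = c) ≤ #(B c) := by
    refine fun c => card_le_card fun v hv => ?_
    simp only [mem_filter] at hv
    obtain ⟨hvY, hvT, rfl⟩ := hv
    rcases hvT with h | h
    · exact absurd hvY (Finset.disjoint_left.1 hXY (mem_filter.1 (hA _ h)).1)
    · exact h
  have hc1 : ∀ x ∈ X, ∀ y ∈ Y, H.Adj x y → x ∈ T ∨ y ∈ T := by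
    intro x hx y hy e
    have hxy : H.connectedComponentMk y = H.connectedComponentMk x :=
      SimpleGraph.ConnectedComponent.sound e.symm.reachable
    rcases hcov (H.connectedComponentMk x) x (by simp [hx]) y (mem_filter.2 ⟨hy, hxy⟩) e with h | h
    · exact Or.inl (Or.inl h)
    · exact Or.inr (Or.inr (hxy ▸ h))
  refine ⟨T, fun u v e => ?_, fun c => ⟨?_, ?_, ?_, ?_⟩⟩
  · rcases hH u v e with ⟨hu, hv⟩ | ⟨hu, hv⟩
    · exact hc1 u hu v hv e
    · exact (hc1 v hv u hu e.symm).symm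
  · have := hTX c; have := hTY c; have := hlt c; omega
  · have := hTX c; have := hTY c; have := hleX c; omega
  · have := hTX c; have := hTY c; have := hleY c; omega
  · intro v hv
    have hpos : 0 < #(A (H.connectedComponentMk v)) + #(B (H.connectedComponentMk v)) := by
      rcases hv with h | h
      · have := card_pos.2 ⟨v, h⟩; omega
      · have := card_pos.2 ⟨v, h⟩; omega
    exact exists_of_count_pos (hpos.trans_le (hleX _))

/-- In a 2-colored bipartite graph of large minimum degree there is a large monochromatic
connected matching. -/
theorem exists_mono_connectedMatching {V : Type*} {R B : SimpleGraph V} {X Y : Finset V}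
    {n d k : ℕ} (hXY : Disjoint X Y)
    (hR : ∀ u v, R.Adj u v → (u ∈ X ∧ v ∈ Y) ∨ (u ∈ Y ∧ v ∈ X))
    (hB : ∀ u v, B.Adj u v → (u ∈ X ∧ v ∈ Y) ∨ (u ∈ Y ∧ v ∈ X))
    (hX : #X = n) (hY : #Y = n) (hn : 0 < n)
    (degX : ∀ x ∈ X, d ≤ Y.count (fun y => R.Adj x y ∨ B.Adj x y))
    (degY : ∀ y ∈ Y, d ≤ X.count (fun x => R.Adj y x ∨ B.Adj y x)) (hk : 0 < k)
    (hkd : 2 * k ≤ d ∨ (2 * k ≤ n ∧ k + n ≤ 2 * d ∧ 2 * n < 3 * d)) :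
    R.HasConnectedMatching X Y k ∨ B.HasConnectedMatching X Y k := by
  by_contra! hno
  obtain ⟨T, covT, hT⟩ := R.exists_cover_of_not_hasConnectedMatching hXY hR hno.1
  obtain ⟨S, covS, hS⟩ := B.exists_cover_of_not_hasConnectedMatching hXY hB hno.2
  have symm : ∀ u v, (R.Adj u v ∨ B.Adj u v) → (R.Adj v u ∨ B.Adj v u) :=
    fun u v => Or.imp SimpleGraph.Adj.symm SimpleGraph.Adj.symm
  have cov : ∀ u v, (R.Adj u v ∨ B.Adj u v) →
      (R.connectedComponentMk u = R.connectedComponentMk v ∧ (u ∈ T ∨ v ∈ T)) ∨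
      (B.connectedComponentMk u = B.connectedComponentMk v ∧ (u ∈ S ∨ v ∈ S)) :=
    fun u v => Or.imp
      (fun e => ⟨SimpleGraph.ConnectedComponent.sound e.reachable, covT u v e⟩)
      (fun e => ⟨SimpleGraph.ConnectedComponent.sound e.reachable, covS u v e⟩)
  rcases hkd with hkd | ⟨h1, h2, h3⟩
  · exact false_of_small_covers cov (card_pos.1 (hX ▸ hn)) degX degY (fun c => (hT c).1)
      (fun c => (hS c).1) (fun c => (hT c).2.1) (fun c => (hT c).2.2.1) (fun c => (hS c).2.1)
      (fun c => (hS c).2.2.1) hkd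
  · have h : LabelledCover (fun u v => R.Adj u v ∨ B.Adj u v) R.connectedComponentMk
        B.connectedComponentMk T S X Y n d k :=
      ⟨symm, cov, hX, hY, degX, degY, fun c => (hT c).1, fun c => (hS c).1, hk, h1, h2, h3⟩
    exact h.false_of_attained (fun v hv => (hT (R.connectedComponentMk v)).2.2.2 v hv)
      (fun v hv => (hS (B.connectedComponentMk v)).2.2.2 v hv)

end ConnectedMatching

/-! ### Refinement of partitions along holes. -/

section HoleRegularity

open Finset
open scoped Classical

/-- There is no `r`-edge between `A` and `B`. -/
def NoEdge {V : Type*} (r : V → V → Prop) (A B : Finset V) : Prop := ∀ a ∈ A, ∀ b ∈ B, ¬ r a b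

/-- Any two subsets of `A` and `B` of size at least `h` span an `r`-edge. -/
def HoleFree {V : Type*} (h : ℕ) (r : V → V → Prop) (A B : Finset V) : Prop :=
  ∀ A' ⊆ A, ∀ B' ⊆ B, h ≤ #A' → h ≤ #B' → ∃ a ∈ A', ∃ b ∈ B', r a b

/-- Families of pairwise disjoint subsets of `X` and of `Y`, all of size `s`. -/
structure EqualParts {V ι : Type*} (X Y : Finset V) (s : ℕ) (A B : ι → Finset V) : Prop where
  subA : ∀ i, A i ⊆ X
  subB : ∀ i, B i ⊆ Y
  disjA : ∀ i j, i ≠ j → Disjoint (A i) (A j)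
  disjB : ∀ i j, i ≠ j → Disjoint (B i) (B j)
  cardA : ∀ i, #(A i) = s
  cardB : ∀ i, #(B i) = s

/-- Greedy choice: while fewer than `t` parts have been taken, more than `Fintype.card L * s`
elements remain when `s > 0`, so some label still occurs `s` times. -/
lemma exists_parts_of_label {V L : Type*} [Fintype L] [Nonempty L] (A : Finset V) (lab : V → L)
    {s t : ℕ} (h : (t + Fintype.card L) * s ≤ #A) :
    ∃ P : Fin t → Finset V, (∀ i, P i ⊆ A) ∧ (∀ i j, i ≠ j → Disjoint (P i) (P j)) ∧
      (∀ i, #(P i) = s) ∧ ∀ i, ∀ x ∈ P i, ∀ y ∈ P i, lab x = lab y := by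
  induction t with
  | zero => exact ⟨fun _ => ∅, fun i => i.elim0, fun i => i.elim0, fun i => i.elim0,
      fun i => i.elim0⟩
  | succ t ih =>
    obtain ⟨P, hPA, hPd, hPc, hPl⟩ := ih (by nlinarith)
    have hU : #(univ.biUnion P) ≤ t * s := by
      refine card_biUnion_le.trans ?_
      simp [hPc]
    have hrest : Fintype.card L * s ≤ #(A \ univ.biUnion P) := by
      have := le_card_sdiff (univ.biUnion P) A
      have e : (t + 1 + Fintype.card L) * s = t * s + s + Fintype.card L * s := by ring
      omega
    obtain ⟨l, -, hl⟩ := exists_le_card_fiber_of_mul_le_card_of_maps_to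
      (s := A \ univ.biUnion P) (t := (univ : Finset L)) (f := lab) (n := s)
      (fun _ _ => mem_univ _) univ_nonempty (by simpa using hrest)
    obtain ⟨Q, hQ, hQc⟩ := exists_subset_card_eq hl
    have hQ' : ∀ x ∈ Q, x ∈ A ∧ (∀ i, x ∉ P i) ∧ lab x = l := fun x hx => by
      have := hQ hx
      simp only [mem_filter, mem_sdiff, mem_biUnion, mem_univ, true_and, not_exists] at this
      exact ⟨this.1.1, this.1.2, this.2⟩
    have hQP : ∀ i, Disjoint Q (P i) := fun i => disjoint_left.2 fun x hx => (hQ' x hx).2.1 i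
    refine ⟨Fin.cons Q P, ?_, ?_, ?_, ?_⟩
    · exact Fin.cases (fun x hx => (hQ' x hx).1) hPA
    · refine Fin.cases (Fin.cases (fun h => absurd rfl h) fun j _ => hQP j)
        fun i => Fin.cases (fun _ => (hQP i).symm) fun j hij => hPd i j fun e => hij (by rw [e])
    · exact Fin.cases hQc hPc
    · exact Fin.cases (fun x hx y hy => (hQ' x hx).2.2.trans (hQ' y hy).2.2.symm) hPl

namespace EqualParts

variable {V ι : Type*} {X Y : Finset V} {s : ℕ} {A B : ι → Finset V}

lemma eq_of_memA (h : EqualParts X Y s A B) {i j : ι} {x : V} (hi : x ∈ A i) (hj : x ∈ A j) :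
    i = j := by
  by_contra hne
  exact disjoint_left.1 (h.disjA i j hne) hi hj

lemma swap (h : EqualParts X Y s A B) : EqualParts Y X s B A :=
  ⟨h.subB, h.subA, h.disjB, h.disjA, h.cardB, h.cardA⟩

variable [Fintype ι]

lemma card_biUnionA (h : EqualParts X Y s A B) : #(univ.biUnion A) = Fintype.card ι * s := by
  rw [card_biUnion fun i _ j _ hij => h.disjA i j hij]
  simp [h.cardA]

lemma card_mul_le (h : EqualParts X Y s A B) : Fintype.card ι * s ≤ #X := by
  rw [← h.card_biUnionA]
  exact card_le_card (biUnion_subset.2 fun i _ => h.subA i)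

/-- The pairs of vertices that lie in a pair of parts without edges. -/
noncomputable def zeroPairs (X Y : Finset V) (A B : ι → Finset V) (r : V → V → Prop) :
    Finset (V × V) :=
  {p ∈ X ×ˢ Y | ∃ i j, p.1 ∈ A i ∧ p.2 ∈ B j ∧ NoEdge r (A i) (B j)}

/-- The pairs of parts that have edges but also have a hole of size `h`. -/
noncomputable def badPairs (A B : ι → Finset V) (h : ℕ) (r : V → V → Prop) : Finset (ι × ι) :=
  {p | ¬ NoEdge r (A p.1) (B p.2) ∧ ¬ HoleFree h r (A p.1) (B p.2)}

/-- Refining the parts along the holes of bad pairs increases the number of pairs of vertices in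
pairs of parts without edges. -/
lemma exists_refinement (P : EqualParts X Y s A B) (r : Bool → V → V → Prop) (h : ℕ) {s' t : ℕ}
    (hst : (t + Fintype.card (Bool → ι → Bool)) * s' ≤ s) :
    ∃ A' B' : ι × Fin t → Finset V, EqualParts X Y s' A' B' ∧ ∀ c,
      #(zeroPairs X Y A B (r c)) + #(badPairs A B h (r c)) * (h * h) ≤
      #(zeroPairs X Y A' B' (r c)) +
        (Fintype.card ι * s - Fintype.card ι * t * s') * (#X + #Y) := by
  have hole : ∀ c i j, ∃ C ⊆ A i, ∃ D ⊆ B j, NoEdge (r c) C D ∧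
      ((i, j) ∈ badPairs A B h (r c) → h ≤ #C ∧ h ≤ #D) := by
    intro c i j
    by_cases hb : (i, j) ∈ badPairs A B h (r c)
    · have hb' := hb
      simp only [badPairs, mem_filter, mem_univ, true_and] at hb'
      unfold HoleFree at hb'
      push Not at hb'
      obtain ⟨-, C, hC, D, hD, h1, h2, h3⟩ := hb'
      exact ⟨C, hC, D, hD, h3, fun _ => ⟨h1, h2⟩⟩
    · exact ⟨∅, by simp, ∅, by simp, by simp [NoEdge], fun hb' => absurd hb' hb⟩
  choose C hC D hD hCD hsize using hole
  -- The label of a vertex records which hole sets contain it. Each piece is thus inside or outside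
  -- every hole set, and holes become edgeless pairs of pieces, up to leftover vertices.
  choose PA hPA hPAd hPAc hPAl using fun i => exists_parts_of_label (A i)
    (fun x c j => decide (x ∈ C c i j)) (s := s') (t := t) (by rw [P.cardA]; exact hst)
  choose PB hPB hPBd hPBc hPBl using fun j => exists_parts_of_label (B j)
    (fun y c i => decide (y ∈ D c i j)) (s := s') (t := t) (by rw [P.cardB]; exact hst)
  have memC : ∀ {c i j u x y}, x ∈ PA i u → y ∈ PA i u → x ∈ C c i j → y ∈ C c i j := by
    intro c i j u x y hx hy hxC
    have := congrFun (congrFun (hPAl i u x hx y hy) c) j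
    simpa [hxC] using this
  have memD : ∀ {c i j u x y}, x ∈ PB j u → y ∈ PB j u → x ∈ D c i j → y ∈ D c i j := by
    intro c i j u x y hx hy hxC
    have := congrFun (congrFun (hPBl j u x hx y hy) c) i
    simpa [hxC] using this
  have Q : EqualParts X Y s' (fun p : ι × Fin t => PA p.1 p.2)
      (fun p : ι × Fin t => PB p.1 p.2) := by
    refine ⟨fun p => (hPA _ _).trans (P.subA _), fun p => (hPB _ _).trans (P.subB _), ?_, ?_,
      fun p => hPAc _ _, fun p => hPBc _ _⟩
    · rintro ⟨i, u⟩ ⟨j, v⟩ hne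
      by_cases hij : i = j
      · subst hij
        exact hPAd i u v fun e => hne (by rw [e])
      · exact disjoint_of_subset_left (hPA _ _)
          (disjoint_of_subset_right (hPA _ _) (P.disjA i j hij))
    · rintro ⟨i, u⟩ ⟨j, v⟩ hne
      by_cases hij : i = j
      · subst hij
        exact hPBd i u v fun e => hne (by rw [e])
      · exact disjoint_of_subset_left (hPB _ _)
          (disjoint_of_subset_right (hPB _ _) (P.disjB i j hij))
  refine ⟨_, _, Q, fun c => ?_⟩
  set A' : ι × Fin t → Finset V := fun p => PA p.1 p.2
  set B' : ι × Fin t → Finset V := fun p => PB p.1 p.2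
  -- the vertices that become uncovered
  let UX := univ.biUnion A \ univ.biUnion A'
  let UY := univ.biUnion B \ univ.biUnion B'
  have hUX : #UX = Fintype.card ι * s - Fintype.card ι * t * s' := by
    rw [card_sdiff_of_subset, P.card_biUnionA, Q.card_biUnionA, Fintype.card_prod, Fintype.card_fin]
    exact biUnion_subset.2 fun p _ => (hPA _ _).trans (subset_biUnion_of_mem A (mem_univ p.1))
  have hUY : #UY = Fintype.card ι * s - Fintype.card ι * t * s' := by
    rw [card_sdiff_of_subset, P.swap.card_biUnionA, Q.swap.card_biUnionA, Fintype.card_prod,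
      Fintype.card_fin]
    exact biUnion_subset.2 fun p _ => (hPB _ _).trans (subset_biUnion_of_mem B (mem_univ p.1))
  let holes : Finset (V × V) := (badPairs A B h (r c)).biUnion fun p => C c p.1 p.2 ×ˢ D c p.1 p.2
  have hholes : #(badPairs A B h (r c)) * (h * h) ≤ #holes := by
    rw [card_biUnion]
    · rw [← smul_eq_mul]
      refine card_nsmul_le_sum _ _ _ fun p hp => ?_
      rw [card_product]
      obtain ⟨h1, h2⟩ := hsize c p.1 p.2 hp
      exact Nat.mul_le_mul h1 h2
    · rintro ⟨i, j⟩ - ⟨i', j'⟩ - hne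
      refine disjoint_left.2 ?_
      rintro ⟨x, y⟩ h1 h2
      rw [mem_product] at h1 h2
      exact hne (Prod.ext (P.eq_of_memA (hC _ _ _ h1.1) (hC _ _ _ h2.1))
        (P.swap.eq_of_memA (hD _ _ _ h1.2) (hD _ _ _ h2.2)))
  have hdisj : Disjoint (zeroPairs X Y A B (r c)) holes := by
    refine disjoint_left.2 ?_
    rintro ⟨x, y⟩ h1 h2
    simp only [zeroPairs, mem_filter, holes, mem_biUnion, mem_product] at h1 h2
    obtain ⟨-, i, j, hx, hy, h0⟩ := h1
    obtain ⟨⟨i', j'⟩, hb, hx', hy'⟩ := h2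
    obtain rfl := P.eq_of_memA hx (hC _ _ _ hx')
    obtain rfl := P.swap.eq_of_memA hy (hD _ _ _ hy')
    simp only [badPairs, mem_filter] at hb
    exact hb.2.1 h0
  have hsub : zeroPairs X Y A B (r c) ∪ holes ⊆
      zeroPairs X Y A' B' (r c) ∪ (UX ×ˢ Y ∪ X ×ˢ UY) := by
    rintro ⟨x, y⟩ hp
    obtain ⟨i, j, hx, hy, h0⟩ : ∃ i j, x ∈ A i ∧ y ∈ B j ∧
        (NoEdge (r c) (A i) (B j) ∨ (x ∈ C c i j ∧ y ∈ D c i j)) := by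
      rcases mem_union.1 hp with hp | hp
      · simp only [zeroPairs, mem_filter] at hp
        obtain ⟨-, i, j, hx, hy, h0⟩ := hp
        exact ⟨i, j, hx, hy, Or.inl h0⟩
      · simp only [holes, mem_biUnion, mem_product] at hp
        obtain ⟨⟨i, j⟩, -, hx, hy⟩ := hp
        exact ⟨i, j, hC _ _ _ hx, hD _ _ _ hy, Or.inr ⟨hx, hy⟩⟩
    have hxX := P.subA _ hx
    have hyY := P.subB _ hy
    by_cases hxU : x ∈ univ.biUnion A'
    · by_cases hyU : y ∈ univ.biUnion B'
      · refine mem_union_left _ ?_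
        simp only [mem_biUnion, mem_univ, true_and] at hxU hyU
        obtain ⟨⟨i', u⟩, hxu⟩ := hxU
        obtain ⟨⟨j', v⟩, hyv⟩ := hyU
        obtain rfl := P.eq_of_memA hx (hPA _ _ hxu)
        obtain rfl := P.swap.eq_of_memA hy (hPB _ _ hyv)
        simp only [zeroPairs, mem_filter, mem_product]
        refine ⟨⟨hxX, hyY⟩, (i, u), (j, v), hxu, hyv, fun a ha b hb => ?_⟩
        rcases h0 with h0 | ⟨h1, h2⟩
        · exact h0 a (hPA _ _ ha) b (hPB _ _ hb)
        · exact hCD c i j a (memC hxu ha h1) b (memD hyv hb h2)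
      · refine mem_union_right _ (mem_union_right _ (mem_product.2 ⟨hxX, mem_sdiff.2 ⟨?_, hyU⟩⟩))
        exact mem_biUnion.2 ⟨j, mem_univ _, hy⟩
    · refine mem_union_right _ (mem_union_left _ (mem_product.2 ⟨mem_sdiff.2 ⟨?_, hxU⟩, hyY⟩))
      exact mem_biUnion.2 ⟨i, mem_univ _, hx⟩
  have h1 := card_le_card hsub
  have h2 := card_union_le (zeroPairs X Y A' B' (r c)) (UX ×ˢ Y ∪ X ×ˢ UY)
  have h3 := card_union_le (UX ×ˢ Y) (X ×ˢ UY)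
  rw [card_union_of_disjoint hdisj] at h1
  rw [card_product, card_product, hUX, hUY] at h3
  have h4 : (Fintype.card ι * s - Fintype.card ι * t * s') * (#X + #Y) =
    (Fintype.card ι * s - Fintype.card ι * t * s') * #Y +
    #X * (Fintype.card ι * s - Fintype.card ι * t * s') := by ring
  omega

end EqualParts

end HoleRegularity

/-! ### Iterated refinement with a bounded potential. -/

section HoleRegularityIteration

open Finset
open scoped Classical

universe u

namespace EqualParts

lemma exists_initial {V : Type*} {X Y : Finset V} {n : ℕ} (hX : #X = n) (hY : #Y = n) (m : ℕ) :
    ∃ A B : Fin m → Finset V, EqualParts X Y (n / (m + 1)) A B := by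
  have hm : (m + Fintype.card Unit) * (n / (m + 1)) ≤ n := by
    rw [Fintype.card_unit]; exact Nat.mul_div_le n (m + 1)
  obtain ⟨A, h1, h2, h3, -⟩ := exists_parts_of_label X (fun _ => ()) (hm.trans hX.ge)
  obtain ⟨B, h1', h2', h3', -⟩ := exists_parts_of_label Y (fun _ => ()) (hm.trans hY.ge)
  exact ⟨A, B, h1, h1', h2, h2', h3, h3'⟩

/-- The division of parts of size `s` into `t` pieces of size `s'` with little loss. -/
lemma exists_piece_size {κ : ℝ} (hκ : 0 < κ) (hκ1 : κ < 1) (K : ℕ) (hK : 0 < K) :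
    ∃ F : ℕ, ∀ s, F ≤ s → ∃ s' t, 0 < t ∧ t ≤ F ∧ (t + K) * s' ≤ s ∧
      (1 - κ) * s ≤ (t * s' : ℕ) := by
  obtain ⟨Q, hQ⟩ := exists_nat_gt (2 / κ)
  have hQ0 : 0 < Q := by
    have : (0 : ℝ) < Q := lt_trans (by positivity) hQ
    exact_mod_cast this
  refine ⟨2 * (K * Q), fun s hs => ?_⟩
  have hKQ : 0 < K * Q := Nat.mul_pos hK hQ0
  -- With `t = s / s' - K`, the `K` unused pieces and the rounding lose at most `2 * K * s' ≤ (2 /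
  -- Q) * s ≤ κ * s`.
  obtain ⟨s', hs'⟩ : ∃ s', s' = s / (K * Q) := ⟨_, rfl⟩
  have h1 : K * Q * s' ≤ s := hs' ▸ Nat.mul_div_le s (K * Q)
  have h2 : s < K * Q * (s' + 1) := hs' ▸ Nat.lt_mul_div_succ s hKQ
  have hs'2 : 0 < s' := by
    rw [hs']; exact Nat.div_pos (by omega) hKQ
  have h3 : s' * (s / s') ≤ s := Nat.mul_div_le s s'
  have h4 : s < s' * (s / s' + 1) := Nat.lt_mul_div_succ s hs'2
  have h5 : s / s' < 2 * (K * Q) := by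
    rw [Nat.div_lt_iff_lt_mul hs'2]
    nlinarith
  have hKs : (K + 1) * s' ≤ 2 * K * s' := by nlinarith
  have hloss : (2 * K * s' : ℝ) ≤ κ * s := by
    have hQ' : 2 < κ * Q := by rwa [div_lt_iff₀ hκ, mul_comm] at hQ
    have h1' : (K * Q * s' : ℝ) ≤ s := by exact_mod_cast h1
    have : (0 : ℝ) ≤ K * s' := by positivity
    nlinarith
  have hs0 : (0 : ℝ) < s := by
    have : 0 < s := by omega
    exact_mod_cast this
  have hKlt : K < s / s' := by
    rw [Nat.lt_iff_add_one_le, Nat.le_div_iff_mul_le hs'2]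
    have : ((K + 1) * s' : ℝ) ≤ s := by
      have : ((K + 1) * s' : ℝ) ≤ 2 * K * s' := by exact_mod_cast hKs
      nlinarith
    exact_mod_cast this
  obtain ⟨t, ht⟩ := Nat.exists_eq_add_of_le hKlt.le
  refine ⟨s', t, by omega, by omega, ?_, ?_⟩
  · rw [add_comm t, ← ht, mul_comm]; exact h3
  · have h6 : s ≤ t * s' + 2 * K * s' := by
      rw [ht] at h4
      nlinarith
    have h6' : (s : ℝ) ≤ t * s' + 2 * K * s' := by exact_mod_cast h6
    push_cast
    linarith

set_option maxHeartbeats 1000000 in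
-- One round for each unit of `τ`. If the parts are still irregular, more than `η * (Fintype.card ι)
-- ^ 2` bad pairs in one color have holes of size `ε * s`. As the parts cover half of each side,
-- refining gains at least `η * ε ^ 2 / 4 * n ^ 2`. The uncovered vertices cost at most `4 * κ * n ^
-- 2` over both colors, so at least half of the gain survives.
lemma exists_regular_or_potential {η ε κ : ℝ} (hη : 0 < η) (hκ : 0 < κ)
    (hκη : 32 * κ ≤ η * ε ^ 2) (hε : 0 < ε) (m₀ : ℕ) (τ : ℕ) (hτ : (τ + 1) * κ ≤ 1 / 2) :
    ∃ L N : ℕ, ∀ n, N ≤ n → ∀ (V : Type u) (X Y : Finset V), #X = n → #Y = n →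
      ∀ r : Bool → V → V → Prop, ∃ (ι : Type) (_ : Fintype ι) (s : ℕ) (A B : ι → Finset V),
        EqualParts X Y s A B ∧ m₀ ≤ Fintype.card ι ∧ Fintype.card ι ≤ L ∧
        (1 - (τ + 1) * κ) * n ≤ (Fintype.card ι * s : ℕ) ∧
        ((∀ c, (#(badPairs A B ⌈ε * s⌉₊ (r c)) : ℝ) ≤ η * (Fintype.card ι : ℝ) ^ 2) ∨
          τ * (η * ε ^ 2 / 8) * (n : ℝ) ^ 2 ≤
            (∑ c, #(zeroPairs X Y A B (r c)) : ℕ)) := by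
  induction τ with
  | zero =>
    obtain ⟨M, hM⟩ := exists_nat_gt (2 / κ)
    obtain ⟨N, hN⟩ := exists_nat_gt (2 * (M + m₀ + 1) / κ)
    refine ⟨M + m₀, N, fun n hn V X Y hX hY r => ?_⟩
    obtain ⟨A, B, h⟩ := exists_initial hX hY (M + m₀)
    refine ⟨Fin (M + m₀), inferInstance, _, A, B, h, by simp, by simp, ?_, Or.inr ?_⟩
    · rw [Fintype.card_fin]
      obtain ⟨s, hs⟩ : ∃ s, s = n / (M + m₀ + 1) := ⟨_, rfl⟩
      have h1 : (M + m₀ + 1) * s ≤ n := hs ▸ Nat.mul_div_le n _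
      have h2 : n < (M + m₀ + 1) * (s + 1) := hs ▸ Nat.lt_mul_div_succ n (by omega)
      rw [← hs]
      have h1' : ((M + m₀ + 1) * s : ℝ) ≤ n := by exact_mod_cast h1
      have h2' : (n : ℝ) < (M + m₀ + 1) * (s + 1) := by exact_mod_cast h2
      have hn' : (N : ℝ) ≤ n := by exact_mod_cast hn
      rw [div_lt_iff₀ hκ] at hM hN
      have h3 : 2 * (M + m₀ + 1 : ℝ) ≤ κ * n := by nlinarith
      have h4 : (2 : ℝ) * s ≤ κ * n := by
        have h5 : (0 : ℝ) ≤ (m₀ + 1) * s := by positivity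
        have h6 : (0 : ℝ) ≤ s := by positivity
        have h7 : (M : ℝ) * s ≤ n := by nlinarith
        nlinarith
      push_cast
      nlinarith
    · simp only [Nat.cast_zero, zero_mul]
      positivity
  | succ τ ih =>
    push_cast at hτ
    obtain ⟨L, N, hLN⟩ := ih (by nlinarith)
    -- The number of labels is bounded through `L`, so that the piece size estimate does not depend
    -- on the partition.
    let K := Fintype.card (Bool → Fin L → Bool)
    have hK0 : 0 < K := Fintype.card_pos
    have hκ1 : κ < 1 := by nlinarith [(Nat.cast_nonneg τ : (0 : ℝ) ≤ τ)]
    obtain ⟨F, hF⟩ := exists_piece_size hκ hκ1 K hK0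
    refine ⟨L + L * F, N + 2 * L * F + 1, fun n hn V X Y hX hY r => ?_⟩
    obtain ⟨ι, _, s, A, B, P, hm₀, hL, hcov, hgood⟩ := hLN n (by omega) V X Y hX hY r
    have hn0 : (0 : ℝ) < n := by
      have : 0 < n := by omega
      exact_mod_cast this
    rcases hgood with hgood | hpot
    · refine ⟨ι, inferInstance, s, A, B, P, hm₀, by omega, ?_, Or.inl hgood⟩
      refine le_trans ?_ hcov
      push_cast
      nlinarith
    by_cases hgood : ∀ c, (#(badPairs A B ⌈ε * s⌉₊ (r c)) : ℝ) ≤ η * (Fintype.card ι : ℝ) ^ 2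
    · refine ⟨ι, inferInstance, s, A, B, P, hm₀, by omega, ?_, Or.inl hgood⟩
      refine le_trans ?_ hcov
      push_cast
      nlinarith
    push Not at hgood
    obtain ⟨c₀, hc₀⟩ := hgood
    have hhalf : (n : ℝ) ≤ 2 * (Fintype.card ι * s : ℕ) := by nlinarith
    have hFs : F ≤ s := by
      by_contra! hlt
      have h1 : n ≤ 2 * (Fintype.card ι * s) := by exact_mod_cast hhalf
      have h2 : Fintype.card ι * s ≤ L * F := Nat.mul_le_mul hL hlt.le
      have h3 : 2 * L * F = 2 * (L * F) := by ring
      omega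
    obtain ⟨s', t, ht0, htF, htK, hts⟩ := hF s hFs
    have hcard : Fintype.card (Bool → ι → Bool) ≤ K := by
      simp only [K, Fintype.card_fun, Fintype.card_bool, Fintype.card_fin]
      exact Nat.pow_le_pow_left (Nat.pow_le_pow_right (by norm_num) hL) 2
    obtain ⟨A', B', P', hA'⟩ := P.exists_refinement r ⌈ε * s⌉₊ (s' := s') (t := t)
      (le_trans (Nat.mul_le_mul_right _ (by omega)) htK)
    have hnew : (1 - κ) * (Fintype.card ι * s : ℕ) ≤ (Fintype.card ι * t * s' : ℕ) := by
      have : (0 : ℝ) ≤ Fintype.card ι := by positivity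
      push_cast at hts ⊢
      nlinarith
    have hms : ((Fintype.card ι * s : ℕ) : ℝ) ≤ n := by
      rw [← hX]; exact_mod_cast P.card_mul_le
    refine ⟨ι × Fin t, inferInstance, s', A', B', P', ?_, ?_, ?_, Or.inr ?_⟩
    · rw [Fintype.card_prod, Fintype.card_fin]
      nlinarith
    · rw [Fintype.card_prod, Fintype.card_fin]
      have := Nat.mul_le_mul hL htF
      omega
    · rw [Fintype.card_prod, Fintype.card_fin]
      refine le_trans ?_ hnew
      push_cast at hcov ⊢
      push_cast at hms
      nlinarith
    · have hsum := sum_le_sum fun c (_ : c ∈ (univ : Finset Bool)) => hA' c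
      rw [sum_add_distrib, sum_add_distrib, sum_const, card_univ, Fintype.card_bool, hX, hY] at hsum
      have hsingle : #(badPairs A B ⌈ε * s⌉₊ (r c₀)) * (⌈ε * s⌉₊ * ⌈ε * s⌉₊) ≤
          ∑ c, #(badPairs A B ⌈ε * s⌉₊ (r c)) * (⌈ε * s⌉₊ * ⌈ε * s⌉₊) :=
        single_le_sum (f := fun c => #(badPairs A B ⌈ε * s⌉₊ (r c)) * (⌈ε * s⌉₊ * ⌈ε * s⌉₊))
          (fun _ _ => Nat.zero_le _) (mem_univ c₀)
      have hloss : ((Fintype.card ι * s - Fintype.card ι * t * s' : ℕ) : ℝ) ≤ κ * n := by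
        have hle : Fintype.card ι * t * s' ≤ Fintype.card ι * s := by
          rw [mul_assoc]
          refine Nat.mul_le_mul_left _ (le_trans ?_ htK)
          exact Nat.mul_le_mul_right _ (by omega)
        rw [Nat.cast_sub hle]
        nlinarith
      have hgain : η * ε ^ 2 * (n : ℝ) ^ 2 / 4 ≤
          (#(badPairs A B ⌈ε * s⌉₊ (r c₀)) * (⌈ε * s⌉₊ * ⌈ε * s⌉₊) : ℕ) := by
        have h1 : ε * s ≤ (⌈ε * s⌉₊ : ℝ) := Nat.le_ceil _
        have h0 : 0 ≤ ε * s := by positivity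
        have h2 : (ε * s) ^ 2 ≤ (⌈ε * s⌉₊ : ℝ) * ⌈ε * s⌉₊ := by nlinarith
        have h3 : (n : ℝ) ^ 2 ≤ 4 * ((Fintype.card ι : ℝ) * s) ^ 2 := by
          push_cast at hhalf
          nlinarith
        push_cast
        calc η * ε ^ 2 * (n : ℝ) ^ 2 / 4
            ≤ η * ε ^ 2 * (4 * ((Fintype.card ι : ℝ) * s) ^ 2) / 4 := by gcongr
          _ = (η * (Fintype.card ι : ℝ) ^ 2) * (ε * s) ^ 2 := by ring
          _ ≤ _ := by gcongr
      have hsum' : ((∑ c, #(zeroPairs X Y A B (r c)) : ℕ) : ℝ) +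
          (#(badPairs A B ⌈ε * s⌉₊ (r c₀)) * (⌈ε * s⌉₊ * ⌈ε * s⌉₊) : ℕ) ≤
          (∑ c, #(zeroPairs X Y A' B' (r c)) : ℕ) +
          2 * ((Fintype.card ι * s - Fintype.card ι * t * s' : ℕ) * (n + n)) := by
        have := hsum.trans' (Nat.add_le_add_left hsingle _)
        rw [smul_eq_mul] at this
        exact_mod_cast this
      push_cast at hsum' hpot hgain ⊢
      have hl2 : 2 * (((Fintype.card ι * s - Fintype.card ι * t * s' : ℕ) : ℝ) * (n + n)) ≤
          η * ε ^ 2 * (n : ℝ) ^ 2 / 8 := by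
        calc _ ≤ 2 * (κ * n * (n + n)) := by gcongr
          _ = 4 * κ * (n : ℝ) ^ 2 := by ring
          _ ≤ (η * ε ^ 2 / 8) * (n : ℝ) ^ 2 := by gcongr; linarith
          _ = _ := by ring
      have e : (τ + 1 : ℝ) * (η * ε ^ 2 / 8) * (n : ℝ) ^ 2 =
        τ * (η * ε ^ 2 / 8) * (n : ℝ) ^ 2 + η * ε ^ 2 * (n : ℝ) ^ 2 / 8 := by ring
      rw [e]
      linarith

/-- A regularity lemma for holes: the sides of a bipartite graph can be almost partitioned into
boundedly many parts of the same size so that, in both colors, almost every pair of parts has no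
edges or has an edge between any two large subsets. -/
theorem exists_regular {η ε : ℝ} (hη : 0 < η) (hε : 0 < ε) (m₀ : ℕ) :
    ∃ L N : ℕ, ∀ n, N ≤ n → ∀ (V : Type u) (X Y : Finset V), #X = n → #Y = n →
      ∀ r : Bool → V → V → Prop, ∃ (ι : Type) (_ : Fintype ι) (s : ℕ) (A B : ι → Finset V),
        EqualParts X Y s A B ∧ m₀ ≤ Fintype.card ι ∧ Fintype.card ι ≤ L ∧
        (1 - η) * n ≤ (Fintype.card ι * s : ℕ) ∧
        ∀ c, (#(badPairs A B ⌈ε * s⌉₊ (r c)) : ℝ) ≤ η * (Fintype.card ι : ℝ) ^ 2 := by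
  -- After this many rounds the potential would exceed its maximum `2 * n ^ 2`.
  obtain ⟨τ, hτ⟩ := exists_nat_gt (2 / (η * ε ^ 2 / 8))
  rw [div_lt_iff₀ (by positivity)] at hτ
  let κ : ℝ := min (min η (1 / 2) / (τ + 1)) (η * ε ^ 2 / 32)
  have hκ : 0 < κ := by positivity
  have hκ1 : (τ + 1) * κ ≤ min η (1 / 2) := by
    have : κ ≤ min η (1 / 2) / (τ + 1) := min_le_left _ _
    rw [le_div_iff₀ (by positivity)] at this
    linarith
  have hκ2 : κ ≤ η * ε ^ 2 / 32 := min_le_right _ _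
  obtain ⟨L, N, hLN⟩ := exists_regular_or_potential.{u} (η := η) (ε := ε) (κ := κ) hη hκ
    (by linarith) hε m₀ τ (hκ1.trans (min_le_right _ _))
  refine ⟨L, N + 1, fun n hn V X Y hX hY r => ?_⟩
  obtain ⟨ι, _, s, A, B, P, hm₀, hL, hcov, hgood⟩ := hLN n (by omega) V X Y hX hY r
  have hn0 : (0 : ℝ) < n := by
    have : 0 < n := by omega
    exact_mod_cast this
  refine ⟨ι, inferInstance, s, A, B, P, hm₀, hL, ?_, ?_⟩
  · refine le_trans ?_ hcov
    have := hκ1.trans (min_le_left _ _)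
    nlinarith
  · refine hgood.resolve_right fun hpot => ?_
    have hle : ∑ c, #(zeroPairs X Y A B (r c)) ≤ 2 * (n * n) := by
      have : ∀ c ∈ (univ : Finset Bool), #(zeroPairs X Y A B (r c)) ≤ n * n := fun c _ => by
        refine (card_filter_le _ _).trans ?_
        rw [card_product, hX, hY]
      simpa using sum_le_sum this
    have hle' : ((∑ c, #(zeroPairs X Y A B (r c)) : ℕ) : ℝ) ≤ 2 * (n * n) := by exact_mod_cast hle
    have : 0 < (n : ℝ) ^ 2 := by positivity
    nlinarith

end EqualParts

end HoleRegularityIteration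

/-! ### Long paths by depth-first search. -/

section CycleEmbedding

open Finset
open scoped Classical

namespace SimpleGraph

variable {V : Type*} {H : SimpleGraph V}

lemma exists_walk_of_isChain {u : V} (v : V) (L : List V) (h : List.IsChain H.Adj (v :: L ++ [u])) :
    ∃ p : H.Walk v u, p.support = v :: L ++ [u] := by
  induction L generalizing v with
  | nil => exact ⟨.cons (by simpa using h) .nil, by simp⟩
  | cons w L ih =>
    rw [List.cons_append, List.cons_append, List.isChain_cons_cons] at h
    obtain ⟨p, hp⟩ := ih w (by simpa using h.2)
    exact ⟨.cons h.1 p, by simp [hp]⟩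

lemma hasCycleOfOrder_of_isChain (x : V) (L : List V) (hc : List.IsChain H.Adj (x :: L ++ [x]))
    (hn : (x :: L).Nodup) (hl : 2 ≤ L.length) : HasCycleOfOrder H (L.length + 1) := by
  obtain _ | ⟨y, L⟩ := L
  · simp at hl
  obtain _ | ⟨z, L⟩ := L
  · simp at hl
  simp only [List.cons_append, List.isChain_cons_cons] at hc
  obtain ⟨p, hp⟩ := exists_walk_of_isChain (u := x) z L (by simpa using hc.2.2)
  refine ⟨x, .cons hc.1 (.cons hc.2.1 p), ?_, ?_⟩
  · rw [Walk.cons_isCycle_iff, Walk.isPath_def, Walk.support_cons, hp]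
    have h2 : (y :: (z :: L ++ [x])).Nodup := by
      have : List.Perm (y :: (z :: L ++ [x])) (x :: y :: z :: L) :=
        List.perm_append_comm (l₁ := y :: z :: L) (l₂ := [x])
      exact this.nodup_iff.2 hn
    refine ⟨h2, fun hmem => ?_⟩
    rw [Walk.edges_cons, List.mem_cons] at hmem
    rcases hmem with e | hmem
    · rw [Sym2.eq_iff] at e
      simp only [List.nodup_cons, List.mem_cons, not_or] at hn
      tauto
    · have := Walk.snd_mem_support_of_mem_edges _ hmem
      rw [hp] at this
      exact (List.nodup_cons.1 h2).1 this
  · have := congrArg List.length hp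
    rw [Walk.length_support] at this
    simp at this ⊢
    omega

/-- The edges of `H` between `A` and `B`, in either direction. -/
def Between (H : SimpleGraph V) (A B : Finset V) (u v : V) : Prop :=
  H.Adj u v ∧ (u ∈ A ∧ v ∈ B ∨ u ∈ B ∧ v ∈ A)

/-- The clauses about the head are what the induction on the list needs. -/
lemma countP_of_alternating {A B : Finset V} (hd : Disjoint A B) (P : List V)
    (hc : P.IsChain (H.Between A B)) (hP : ∀ x ∈ P, x ∈ A ∨ x ∈ B) :
    P.countP (· ∈ A) ≤ P.countP (· ∈ B) + 1 ∧ P.countP (· ∈ B) ≤ P.countP (· ∈ A) + 1 ∧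
      (∀ x ∈ P.head?, x ∈ A → P.countP (· ∈ B) ≤ P.countP (· ∈ A)) ∧
      (∀ x ∈ P.head?, x ∈ B → P.countP (· ∈ A) ≤ P.countP (· ∈ B)) ∧
      P.countP (· ∈ A) + P.countP (· ∈ B) = P.length := by
  induction P with
  | nil => simp
  | cons a P ih =>
    have h0 := ih hc.of_cons fun x hx => hP x (List.mem_cons_of_mem _ hx)
    have hab : a ∈ A → a ∉ B := fun h h' => Finset.disjoint_left.1 hd h h'
    have ha := hP a List.mem_cons_self
    obtain _ | ⟨b, P⟩ := P
    · by_cases h1 : a ∈ A <;> by_cases h2 : a ∈ B <;> simp_all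
    · have hb := (List.isChain_cons_cons.1 hc).1.2
      simp only [List.head?_cons, Option.mem_some_iff, forall_eq'] at h0 ⊢
      obtain ⟨h1, h2, h3, h4, h5⟩ := h0
      rw [List.countP_cons (l := b :: P), List.countP_cons (l := b :: P), List.length_cons]
      by_cases haA : a ∈ A
      · have haB := hab haA
        have hbB : b ∈ B := by tauto
        have := h4 hbB
        simp only [haA, haB, decide_true, decide_false, if_true, Bool.false_eq_true, if_false,
          true_implies, false_implies, true_and]
        omega
      · have haB : a ∈ B := by tauto
        have hbB : b ∈ A := by tauto
        have := h3 hbB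
        simp only [haA, haB, decide_true, decide_false, if_true, Bool.false_eq_true, if_false,
          true_implies, false_implies, true_and]
        omega

lemma le_countP_of_alternating {A B : Finset V} (hd : Disjoint A B) {P : List V}
    (hc : P.IsChain (H.Between A B)) (hP : ∀ x ∈ P, x ∈ A ∨ x ∈ B) :
    P.length ≤ 2 * P.countP (· ∈ A) + 1 ∧ 2 * P.countP (· ∈ A) ≤ P.length + 1 ∧
    P.length ≤ 2 * P.countP (· ∈ B) + 1 ∧ 2 * P.countP (· ∈ B) ≤ P.length + 1 := by
  have := countP_of_alternating hd P hc hP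
  omega

lemma card_filter_toFinset {P : List V} (hn : P.Nodup) (A : Finset V) :
    #{x ∈ P.toFinset | x ∈ A} = P.countP (· ∈ A) := by
  rw [List.countP_eq_length_filter, ← List.toFinset_card_of_nodup (hn.filter _),
    List.toFinset_filter]
  simp only [decide_eq_true_eq]

/-- A state of the depth-first search: `P` is an alternating path, `D` are the vertices given up. -/
structure SearchState (H : SimpleGraph V) (A B : Finset V) (h : ℕ) (D : Finset V) (P : List V) :
    Prop where
  sub : ∀ x ∈ D, x ∈ A ∨ x ∈ B
  cardA : #{x ∈ D | x ∈ A} < h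
  cardB : #{x ∈ D | x ∈ B} < h
  nodup : P.Nodup
  chain : P.IsChain (H.Between A B)
  mem : ∀ x ∈ P, x ∈ A ∨ x ∈ B
  notMem : ∀ x ∈ P, x ∉ D
  noEdge : ∀ x ∈ D, ∀ y, y ∉ D → y ∉ P → ¬ H.Between A B x y

lemma Between.swap {A B : Finset V} {u v : V} (h : H.Between A B u v) : H.Between B A u v :=
  ⟨h.1, h.2.symm⟩

lemma SearchState.swap {A B D : Finset V} {P : List V} {h : ℕ} (S : SearchState H A B h D P) :
    SearchState H B A h D P where
  sub x hx := (S.sub x hx).symm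
  cardA := S.cardB
  cardB := S.cardA
  nodup := S.nodup
  chain := S.chain.imp fun _ _ => Between.swap
  mem x hx := (S.mem x hx).symm
  notMem := S.notMem
  noEdge x hx y h1 h2 h3 := S.noEdge x hx y h1 h2 h3.swap

/-- The quantity `2 * #D + P.length` measures the progress of the search; here it is bounded. -/
lemma SearchState.card_le {A B D : Finset V} {P : List V} {h : ℕ} (S : SearchState H A B h D P) :
    2 * #D + P.length ≤ 2 * #(A ∪ B) := by
  have : #(D ∪ P.toFinset) ≤ #(A ∪ B) := by
    refine card_le_card fun x hx => ?_
    rw [mem_union, List.mem_toFinset] at hx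
    rw [mem_union]
    exact hx.elim (S.sub x) (S.mem x)
  rw [card_union_of_disjoint, List.toFinset_card_of_nodup S.nodup] at this
  · omega
  · exact Finset.disjoint_left.2 fun x hx hx' => S.notMem x (List.mem_toFinset.1 hx') hx

lemma SearchState.card_rest {A B D : Finset V} {P : List V} {h m : ℕ} (hd : Disjoint A B)
    (hA : m + 2 * h ≤ #A) (S : SearchState H A B h D P) (hP : P.length < 2 * m) :
    h < #{x ∈ A | x ∉ D ∧ x ∉ P} := by
  have h1 := (le_countP_of_alternating hd S.chain S.mem).2.1
  rw [← card_filter_toFinset S.nodup] at h1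
  have h2 := S.cardA
  have : A ⊆ {x ∈ A | x ∉ D ∧ x ∉ P} ∪ {x ∈ D | x ∈ A} ∪ {x ∈ P.toFinset | x ∈ A} := by
    intro x hx
    simp only [mem_union, mem_filter, List.mem_toFinset]
    tauto
  have h3 := (card_le_card this).trans ((card_union_le _ _).trans
    (Nat.add_le_add_right (card_union_le _ _) _))
  omega

/-- If giving up `v` brought the abandoned vertices of `A` to `h`, they would form a hole with the
more than `h` vertices of `B` not yet visited. -/
lemma SearchState.backtrack {A B D : Finset V} {v : V} {P : List V} {h m : ℕ} (hd : Disjoint A B)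
    (hf : HoleFree h H.Adj A B) (hB : m + 2 * h ≤ #B) (S : SearchState H A B h D (v :: P))
    (hP : (v :: P).length < 2 * m) (hv : v ∈ A)
    (hno : ∀ y, y ∉ D → y ∉ v :: P → ¬ H.Between A B v y) :
    SearchState H A B h (insert v D) P := by
  have hvB : v ∉ B := Finset.disjoint_left.1 hd hv
  have hno' : ∀ x ∈ insert v D, ∀ y, y ∉ insert v D → y ∉ P → ¬ H.Between A B x y := by
    intro x hx y hy hyP
    rw [mem_insert, not_or] at hy
    have hyP' : y ∉ v :: P := by simp [hy.1, hyP]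
    rcases mem_insert.1 hx with rfl | hx
    · exact hno y hy.2 hyP'
    · exact S.noEdge x hx y hy.2 hyP'
  refine ⟨?_, ?_, ?_, S.nodup.of_cons, S.chain.of_cons,
    fun x hx => S.mem x (List.mem_cons_of_mem _ hx), ?_, hno'⟩
  · intro x hx
    rcases mem_insert.1 hx with rfl | hx
    · exact Or.inl hv
    · exact S.sub x hx
  · by_contra! hge
    have hU := S.swap.card_rest hd.symm hB hP
    obtain ⟨a, ha, b, hb, hab⟩ := hf {x ∈ insert v D | x ∈ A}
      (fun x hx => (mem_filter.1 hx).2) {x ∈ B | x ∉ D ∧ x ∉ v :: P}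
      (fun x hx => (mem_filter.1 hx).1) hge hU.le
    rw [mem_filter] at ha hb
    rw [List.mem_cons, not_or] at hb
    exact hno' a ha.1 b (by simp [hb.2.1, hb.2.2.1]) hb.2.2.2 ⟨hab, Or.inl ⟨ha.2, hb.1⟩⟩
  · rw [filter_insert, if_neg hvB]
    exact S.cardB
  · intro x hx hx'
    rcases mem_insert.1 hx' with rfl | hx'
    · exact (List.nodup_cons.1 S.nodup).1 hx
    · exact S.notMem x (List.mem_cons_of_mem _ hx) hx'

lemma SearchState.extend {A B D : Finset V} {y : V} {P : List V} {h : ℕ}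
    (S : SearchState H A B h D P) (hy : y ∈ A ∨ y ∈ B) (hyD : y ∉ D) (hyP : y ∉ P)
    (hP : ∀ v ∈ P.head?, H.Between A B v y) : SearchState H A B h D (y :: P) := by
  refine ⟨S.sub, S.cardA, S.cardB, List.nodup_cons.2 ⟨hyP, S.nodup⟩, ?_, ?_, ?_, ?_⟩
  · rw [List.isChain_cons]
    refine ⟨fun v hv => ?_, S.chain⟩
    have := hP v hv
    exact ⟨this.1.symm, this.2.symm.imp And.symm And.symm⟩
  · simpa using ⟨hy, S.mem⟩
  · simpa using ⟨hyD, S.notMem⟩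
  · exact fun x hx z hz hz' => S.noEdge x hx z hz fun h => hz' (List.mem_cons_of_mem _ h)

/-- Extending the path adds one to the measure. Moving its head to `D` adds two and removes one. -/
lemma SearchState.exists_next {A B D : Finset V} {P : List V} {h m : ℕ} (hd : Disjoint A B)
    (hf : HoleFree h H.Adj A B) (hf' : HoleFree h H.Adj B A)
    (hA : m + 2 * h ≤ #A) (hB : m + 2 * h ≤ #B)
    (S : SearchState H A B h D P) (hP : P.length < 2 * m) :
    ∃ D' P', SearchState H A B h D' P' ∧ 2 * #D + P.length < 2 * #D' + P'.length := by
  obtain _ | ⟨v, P⟩ := P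
  · obtain ⟨y, hy⟩ := card_pos.1 ((Nat.zero_le _).trans_lt (S.card_rest hd hA hP))
    rw [mem_filter] at hy
    exact ⟨D, [y], S.extend (Or.inl hy.1) hy.2.1 hy.2.2 (by simp), by simp⟩
  by_cases hex : ∃ y, y ∉ D ∧ y ∉ v :: P ∧ H.Between A B v y
  · obtain ⟨y, hyD, hyP, hy⟩ := hex
    exact ⟨D, y :: v :: P, S.extend (by have := hy.2; tauto) hyD hyP (by simpa using hy), by simp⟩
  push Not at hex
  have hvD : v ∉ D := S.notMem v List.mem_cons_self
  refine ⟨insert v D, P, ?_, by rw [card_insert_of_notMem hvD, List.length_cons]; omega⟩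
  rcases S.mem v List.mem_cons_self with hv | hv
  · exact S.backtrack hd hf hB hP hv hex
  · exact (S.swap.backtrack hd.symm hf' hA hP hv fun y h1 h2 h3 => hex y h1 h2 h3.swap).swap

/-- Between two large sets without holes there is a path covering almost everything. -/
lemma exists_long_path {A B : Finset V} {h m : ℕ} (hd : Disjoint A B) (hf : HoleFree h H.Adj A B)
    (hA : m + 2 * h ≤ #A) (hB : m + 2 * h ≤ #B) :
    ∃ P : List V, P.Nodup ∧ P.IsChain (H.Between A B) ∧ (∀ x ∈ P, x ∈ A ∨ x ∈ B) ∧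
      P.length = 2 * m := by
  have hf' : HoleFree h H.Adj B A := fun S hS T hT hS' hT' =>
    let ⟨a, ha, b, hb, hab⟩ := hf T hT S hS hT' hS'
    ⟨b, hb, a, ha, hab.symm⟩
  have hh : 0 < h := by
    by_contra h0
    obtain ⟨a, ha, -⟩ := hf ∅ (by simp) ∅ (by simp) (by simpa using h0) (by simpa using h0)
    simp at ha
  by_contra hno
  -- Unless a path of the desired length appears, the measure grows without bound, against
  -- `SearchState.card_le`.
  have key : ∀ t, ∃ D P, SearchState H A B h D P ∧ t ≤ 2 * #D + P.length := by
    intro t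
    induction t with
    | zero => exact ⟨∅, [], ⟨by simp, by simpa, by simpa, by simp, by simp, by simp, by simp,
        by simp⟩, by simp⟩
    | succ t ih =>
      obtain ⟨D, P, S, ht⟩ := ih
      by_cases hP : P.length < 2 * m
      · obtain ⟨D', P', S', ht'⟩ := S.exists_next hd hf hf' hA hB hP
        exact ⟨D', P', S', by omega⟩
      · refine absurd ⟨P.take (2 * m), S.nodup.sublist (List.take_sublist _ _), S.chain.take _,
          fun x hx => S.mem x (List.mem_of_mem_take hx), ?_⟩ hno
        rw [List.length_take]
        omega
  obtain ⟨D, P, S, ht⟩ := key (2 * #(A ∪ B) + 1)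
  have := S.card_le
  omega

/-- The path of `exists_long_path`, with its end segments `P₁` and `P₃` singled out. -/
lemma exists_long_path_with_ends {A B : Finset V} {h m : ℕ} (hd : Disjoint A B)
    (hf : HoleFree h H.Adj A B) (hA : m + 2 * h ≤ #A) (hB : m + 2 * h ≤ #B) (hm : 2 * h ≤ m) :
    ∃ P₁ P₂ P₃ : List V, (P₁ ++ P₂ ++ P₃).Nodup ∧ (P₁ ++ P₂ ++ P₃).IsChain H.Adj ∧
      (∀ x ∈ P₁ ++ P₂ ++ P₃, x ∈ A ∨ x ∈ B) ∧ P₂.length = 2 * m - 4 * h ∧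
      h ≤ #{x ∈ P₁.toFinset | x ∈ A} ∧ h ≤ #{x ∈ P₃.toFinset | x ∈ A} ∧
      #{x ∈ (P₁ ++ P₂ ++ P₃).toFinset | x ∈ A} ≤ m ∧
      #{x ∈ (P₁ ++ P₂ ++ P₃).toFinset | x ∈ B} ≤ m := by
  obtain ⟨P, hn, hc, hP, hl⟩ := exists_long_path hd hf hA hB
  have e : P.take (2 * h) ++ (P.drop (2 * h)).take (2 * m - 4 * h) ++
      (P.drop (2 * h)).drop (2 * m - 4 * h) = P := by
    rw [List.append_assoc, List.take_append_drop, List.take_append_drop]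
  have hc' := hc
  have hn' := hn
  have hP' := hP
  rw [← e] at hc' hn' hP'
  have c1 := (le_countP_of_alternating hd (List.isChain_append.1 (List.isChain_append.1 hc').1).1
    fun x hx => hP' x (by rw [List.mem_append, List.mem_append]; exact Or.inl (Or.inl hx))).1
  have c3 := (le_countP_of_alternating hd (List.isChain_append.1 hc').2.1
    fun x hx => hP' x (by rw [List.mem_append]; exact Or.inr hx)).1
  have c := le_countP_of_alternating hd hc hP
  rw [List.nodup_append, List.nodup_append] at hn'
  refine ⟨_, _, _, by rw [e]; exact hn, by rw [e]; exact hc.imp fun _ _ h => h.1,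
    by rw [e]; exact hP, ?_, ?_, ?_, ?_, ?_⟩
  · rw [List.length_take, List.length_drop]; omega
  · rw [card_filter_toFinset hn'.1.1]
    rw [List.length_take] at c1
    omega
  · rw [card_filter_toFinset hn'.2.1]
    rw [List.length_drop, List.length_drop] at c3
    omega
  · rw [e, card_filter_toFinset hn]; omega
  · rw [e, card_filter_toFinset hn]; omega

end SimpleGraph

end CycleEmbedding

/-! ### Linking paths into a cycle. -/

section CycleGluing

open Finset
open scoped Classical

namespace SimpleGraph

variable {V : Type*} {H : SimpleGraph V}

/-- A path through clusters, following a path of the cluster graph. -/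
lemma exists_link {J : Type*} {Γ : SimpleGraph J} {C Z : J → Finset V} {h : ℕ}
    (hC : ∀ i j, i ≠ j → Disjoint (C i) (C j))
    (hΓ : ∀ i j, Γ.Adj i j → HoleFree h H.Adj (C i) (C j)) (hZ : ∀ j, Z j ⊆ C j)
    (hZc : ∀ j, 2 * h ≤ #(Z j)) {i' j : J} (w : Γ.Walk i' j) (hw : w.IsPath) {T : Finset V}
    (hT : T ⊆ C j) (hTc : h ≤ #T) {i : J} (hi : Γ.Adj i i') {S : Finset V} (hS : S ⊆ C i)
    (hSc : h ≤ #S) :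
    ∃ x ∈ S, ∃ y ∈ T, ∃ K : List V, (x :: K ++ [y]).IsChain H.Adj ∧ K.Nodup ∧
      (∀ z ∈ K, ∃ v ∈ w.support, z ∈ Z v) ∧ K.length ≤ w.length := by
  induction w generalizing i S with
  | nil =>
    obtain ⟨x, hx, y, hy, hxy⟩ := hΓ _ _ hi S hS T hT hSc hTc
    exact ⟨x, hx, y, hy, [], by simpa using hxy, by simp, by simp, by simp⟩
  | @cons u v _ huv p ih =>
    rw [Walk.cons_isPath_iff] at hw
    -- Fewer than `h` neighbors in `Z u` would leave at least `h` vertices of `Z u` forming a hole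
    -- with `S`. So the walk continues with the set of neighbors in place of `S`.
    have hS' : h ≤ #{z ∈ Z u | ∃ x ∈ S, H.Adj x z} := by
      by_contra! hlt
      have := card_filter_add_card_filter_not (s := Z u) (fun z => ∃ x ∈ S, H.Adj x z)
      have h2 := hZc u
      obtain ⟨x, hx, z, hz, hxz⟩ := hΓ _ _ hi S hS {z ∈ Z u | ¬ ∃ x ∈ S, H.Adj x z}
        (fun z hz => hZ u (mem_filter.1 hz).1) hSc (by omega)
      exact (mem_filter.1 hz).2 ⟨x, hx, hxz⟩
    obtain ⟨z, hz, y, hy, K, hK, hKn, hKZ, hKl⟩ := ih hw.1 hT huv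
      (fun z hz => hZ u (mem_filter.1 hz).1) hS'
    rw [mem_filter] at hz
    obtain ⟨hzZ, x, hx, hxz⟩ := hz
    refine ⟨x, hx, y, hy, z :: K, ?_, ?_, ?_, by simpa using hKl⟩
    · rw [List.cons_append, List.cons_append, List.isChain_cons_cons]
      exact ⟨hxz, by simpa using hK⟩
    · refine List.nodup_cons.2 ⟨fun hzK => ?_, hKn⟩
      obtain ⟨t, ht, hzt⟩ := hKZ z hzK
      have hne : u ≠ t := fun e => hw.2 (e ▸ ht)
      exact Finset.disjoint_left.1 (hC u t hne) (hZ u hzZ) (hZ t hzt)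
    · intro a ha
      rw [Walk.support_cons]
      rcases List.mem_cons.1 ha with rfl | ha
      · exact ⟨u, List.mem_cons_self, hzZ⟩
      · obtain ⟨t, ht, hat⟩ := hKZ a ha
        exact ⟨t, List.mem_cons_of_mem _ ht, hat⟩

/-- Greedy choice: `F` is the union of the supports chosen before. -/
lemma exists_disjoint_choice {T V : Type*} [Nonempty T] {k b : ℕ} (p : ℕ → T → Prop)
    (supp : T → Finset V)
    (h : ∀ l < k, ∀ F : Finset V, #F ≤ k * b → ∃ t, p l t ∧ #(supp t) ≤ b ∧ Disjoint (supp t) F) :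
    ∃ t : ℕ → T, (∀ l < k, p l (t l)) ∧
      ∀ l < k, ∀ l' < k, l ≠ l' → Disjoint (supp (t l)) (supp (t l')) := by
  have key : ∀ j ≤ k, ∃ t : ℕ → T, (∀ l < j, p l (t l) ∧ #(supp (t l)) ≤ b) ∧
      ∀ l < j, ∀ l' < j, l ≠ l' → Disjoint (supp (t l)) (supp (t l')) := by
    intro j
    induction j with
    | zero => exact fun _ => ⟨fun _ => Classical.arbitrary T, by simp, by simp⟩
    | succ j ih =>
      intro hj
      obtain ⟨t, ht, htd⟩ := ih (by omega)
      have hF : #((range j).biUnion fun l => supp (t l)) ≤ k * b := by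
        refine (card_biUnion_le_card_mul _ _ b fun l hl => (ht l (mem_range.1 hl)).2).trans ?_
        rw [card_range]
        exact Nat.mul_le_mul_right _ (by omega)
      obtain ⟨u, hu, hub, hud⟩ := h j (by omega) _ hF
      have hud' : ∀ l < j, Disjoint (supp u) (supp (t l)) := fun l hl =>
        hud.mono_right (subset_biUnion_of_mem (fun l => supp (t l)) (mem_range.2 hl))
      refine ⟨Function.update t j u, fun l hl => ?_, fun l hl l' hl' hne => ?_⟩
      · by_cases e : l = j
        · subst e; simpa using ⟨hu, hub⟩
        · simpa [e] using ht l (by omega)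
      · by_cases e : l = j
        · subst e
          simpa [hne.symm] using hud' l' (by omega)
        · by_cases e' : l' = j
          · subst e'
            simpa [hne] using (hud' l (by omega)).symm
          · simpa [e, e'] using htd l (by omega) l' (by omega) hne
  obtain ⟨t, ht, htd⟩ := key k le_rfl
  exact ⟨t, fun l hl => (ht l hl).1, htd⟩

lemma exists_segment {P₁ P₂ P₃ : List V} {t x : V} (ht : t ∈ P₁) (hx : x ∈ P₃) :
    ∃ Q, t :: Q ++ [x] <:+: P₁ ++ P₂ ++ P₃ ∧ P₂.length ≤ Q.length := by
  obtain ⟨a, b, rfl⟩ := List.append_of_mem ht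
  obtain ⟨c, d, rfl⟩ := List.append_of_mem hx
  exact ⟨b ++ P₂ ++ c, ⟨a, d, by simp⟩, by simp; omega⟩

/-- Paths, cyclically connected by disjoint links from their ends to the beginnings of the next,
form a cycle. -/
lemma exists_cycle_of_links {k q : ℕ} (hq : 2 ≤ q) (P₁ P₂ P₃ K : ℕ → List V) (x y : ℕ → V)
    (hper : P₁ (k + 1) = P₁ 0)
    (hc : ∀ n < k + 1, (P₁ n ++ P₂ n ++ P₃ n).IsChain H.Adj)
    (hn : ∀ n < k + 1, (P₁ n ++ P₂ n ++ P₃ n).Nodup)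
    (hd : ∀ n < k + 1, ∀ n' < k + 1, n ≠ n' →
      List.Disjoint (P₁ n ++ P₂ n ++ P₃ n) (P₁ n' ++ P₂ n' ++ P₃ n'))
    (hl : ∀ n < k + 1, q ≤ (P₂ n).length)
    (hx : ∀ n < k + 1, x n ∈ P₃ n) (hy : ∀ n < k + 1, y n ∈ P₁ (n + 1))
    (hK : ∀ n < k + 1, (x n :: K n ++ [y n]).IsChain H.Adj)
    (hKn : ∀ n < k + 1, (K n).Nodup)
    (hKP : ∀ n < k + 1, ∀ n' < k + 1, List.Disjoint (K n) (P₁ n' ++ P₂ n' ++ P₃ n'))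
    (hKd : ∀ n < k + 1, ∀ n' < k + 1, n ≠ n' → List.Disjoint (K n) (K n')) :
    ∃ N, (k + 1) * q ≤ N ∧ HasCycleOfOrder H N := by
  -- `t n` is where the preceding link enters the path `n`, with `t 0` the end of the last link.
  let t : ℕ → V := fun n => Nat.casesOn n (y k) y
  have ht : ∀ n < k + 1, t n ∈ P₁ n := by
    rintro (_ | n) hnk
    · have := hy k (by omega)
      rw [hper] at this
      exact this
    · exact hy n (by omega)
  have hQ : ∀ n, ∃ Q, n < k + 1 → t n :: Q ++ [x n] <:+: P₁ n ++ P₂ n ++ P₃ n ∧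
      (P₂ n).length ≤ Q.length := by
    intro n
    by_cases h : n < k + 1
    · obtain ⟨Q, hQ⟩ := exists_segment (P₂ := P₂ n) (ht n h) (hx n h)
      exact ⟨Q, fun _ => hQ⟩
    · exact ⟨[], fun h' => absurd h' h⟩
  choose Q hQ using hQ
  let M : ℕ → List V := fun n => t n :: Q n ++ [x n] ++ K n
  have hM : ∀ n < k + 1, (M n ++ [t (n + 1)]).IsChain H.Adj := by
    intro n h
    have h1 : (t n :: Q n ++ [x n]).IsChain H.Adj := (hc n h).infix (hQ n h).1
    have h2 : ([x n] ++ (K n ++ [y n])).IsChain H.Adj := by simpa using hK n h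
    have := h1.append_overlap h2 (by simp)
    simpa [M, t] using this
  have hchain : ∀ j ≤ k + 1, ((List.range j).flatMap M ++ [t j]).IsChain H.Adj := by
    intro j
    induction j with
    | zero => simp
    | succ j ih =>
      intro hj
      rw [List.range_succ, List.flatMap_append, List.append_assoc]
      have h1 := ih (by omega)
      have h2 := hM j (by omega)
      have h3 : M j = [t j] ++ (Q j ++ [x j] ++ K j) := by simp [M]
      have := h1.append_overlap (l₃ := Q j ++ [x j] ++ K j ++ [t (j + 1)])
        (by rw [h3] at h2; simpa using h2) (by simp)
      simpa [h3] using this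
  have hsub : ∀ n < k + 1, ∀ a ∈ M n, a ∈ P₁ n ++ P₂ n ++ P₃ n ∨ a ∈ K n := by
    intro n h a ha
    rcases List.mem_append.1 ha with ha | ha
    · exact Or.inl ((hQ n h).1.subset ha)
    · exact Or.inr ha
  have hnodup : ((List.range (k + 1)).flatMap M).Nodup := by
    rw [List.nodup_flatMap]
    refine ⟨fun n h => ?_, ?_⟩
    · rw [List.mem_range] at h
      refine List.Nodup.append ((hn n h).sublist (hQ n h).1.sublist) (hKn n h) ?_
      exact fun a ha ha' => hKP n h n h ha' ((hQ n h).1.subset ha)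
    · refine List.Pairwise.imp_of_mem ?_ List.nodup_range
      intro n n' h h' hne a ha ha'
      rw [List.mem_range] at h h'
      rcases hsub n h a ha with ha | ha <;> rcases hsub n' h' a ha' with ha' | ha'
      · exact hd n h n' h' hne ha ha'
      · exact hKP n' h' n h ha' ha
      · exact hKP n h n' h' ha ha'
      · exact hKd n h n' h' hne ha ha'
  have hlen : ∀ j ≤ k + 1, j * q ≤ ((List.range j).flatMap M).length := by
    intro j
    induction j with
    | zero => simp
    | succ j ih =>
      intro hj
      have h1 := ih (by omega)
      have h2 := hl j (by omega)
      have h3 := (hQ j (by omega)).2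
      have h4 : (M j).length = (Q j).length + 2 + (K j).length := by simp [M]; omega
      rw [List.range_succ, List.flatMap_append, List.length_append, List.flatMap_singleton,
        Nat.add_mul]
      omega
  have hlen1 := hlen (k + 1) le_rfl
  obtain ⟨L, hL⟩ : ∃ L, (List.range (k + 1)).flatMap M = t 0 :: L := by
    rw [List.range_succ_eq_map]
    exact ⟨_, by rw [List.flatMap_cons]; rfl⟩
  have hlen2 : 3 ≤ (t 0 :: L).length := by
    rw [← hL, List.range_succ_eq_map, List.flatMap_cons, List.length_append]
    have h2 := hl 0 (by omega)
    have h3 := (hQ 0 (by omega)).2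
    have h4 : (M 0).length = (Q 0).length + 2 + (K 0).length := by simp [M]; omega
    omega
  have hcyc := hchain (k + 1) le_rfl
  rw [hL] at hcyc hnodup hlen1
  refine ⟨L.length + 1, by simpa using hlen1, hasCycleOfOrder_of_isChain (t 0) L hcyc hnodup ?_⟩
  simpa using hlen2

end SimpleGraph

end CycleGluing

/-! ### From connected matchings of clusters to cycles. -/

section CycleOfMatching

open Finset
open scoped Classical

namespace SimpleGraph

variable {V : Type*} {H : SimpleGraph V}

/-- A connected matching of the cluster graph yields a cycle covering almost all of the
clusters of the matching. -/
theorem exists_cycle_of_hasConnectedMatching {J : Type*} [Fintype J] {Γ : SimpleGraph J}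
    {C : J → Finset V} {h s k : ℕ} {I₁ I₂ : Finset J} (hI : Disjoint I₁ I₂)
    (M : Γ.HasConnectedMatching I₁ I₂ k) (hk : 0 < k)
    (hC : ∀ i j, i ≠ j → Disjoint (C i) (C j)) (hCs : ∀ j, #(C j) = s)
    (hΓ : ∀ i j, Γ.Adj i j → HoleFree h H.Adj (C i) (C j))
    (hs : 8 * h ≤ s) (hJ : Fintype.card J * Fintype.card J ≤ 2 * h) :
    ∃ N, k * (2 * s - 12 * h) ≤ N ∧ HasCycleOfOrder H N := by
  obtain ⟨f, g, hf, hg, hfI, hgI, hfg, hconn⟩ := M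
  have hne : ∀ l l', f l ≠ g l' := fun l l' e =>
    Finset.disjoint_left.1 hI (hfI l) (e ▸ hgI l')
  have hkJ : k ≤ Fintype.card J := by simpa using Fintype.card_le_of_injective f hf
  have hJ0 : 0 < Fintype.card J := by omega
  have hh : 0 < h := by have := Nat.mul_pos hJ0 hJ0; omega
  -- The choice `m = s - 4 * h` leaves `4 * h` unused vertices in every cluster for the links, and
  -- the middle of each path has `2 * s - 12 * h` vertices.
  have hpath := fun l => exists_long_path_with_ends (m := s - 4 * h) (hC _ _ (hne l l))
    (hΓ _ _ (hfg l)) (by rw [hCs]; omega) (by rw [hCs]; omega) (by omega)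
  choose P₁ P₂ P₃ hPn hPc hPm hPl hP₁ hP₃ hPA hPB using hpath
  have hown : ∀ l l' z, z ∈ P₁ l ++ P₂ l ++ P₃ l → z ∈ C (f l') ∨ z ∈ C (g l') → l = l' := by
    intro l l' z hz hz'
    by_contra hll
    have h1 := hC _ _ (fun e => hll (hf e))
    have h2 := hC _ _ (fun e => hll (hg e))
    have h3 := hC _ _ (hne l l')
    have h4 := hC _ _ (hne l' l)
    rw [Finset.disjoint_left] at h1 h2 h3 h4
    rcases hPm l z hz with hz | hz <;> rcases hz' with hz' | hz'
    exacts [h1 hz hz', h3 hz hz', h4 hz' hz, h2 hz hz']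
  let Z : J → Finset V := fun j => {z ∈ C j | ∀ l, z ∉ P₁ l ++ P₂ l ++ P₃ l}
  have hZC : ∀ j, Z j ⊆ C j := fun j => filter_subset _ _
  have hZc : ∀ j, 4 * h ≤ #(Z j) := by
    intro j
    have hused : #{z ∈ C j | ¬ ∀ l, z ∉ P₁ l ++ P₂ l ++ P₃ l} ≤ s - 4 * h := by
      by_cases h1 : ∃ l, f l = j
      · obtain ⟨l, rfl⟩ := h1
        refine (card_le_card fun z hz => ?_).trans (hPA l)
        simp only [mem_filter, not_forall, not_not] at hz
        obtain ⟨hz, l', hz'⟩ := hz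
        obtain rfl := hown l' l z hz' (Or.inl hz)
        exact mem_filter.2 ⟨List.mem_toFinset.2 hz', hz⟩
      by_cases h2 : ∃ l, g l = j
      · obtain ⟨l, rfl⟩ := h2
        refine (card_le_card fun z hz => ?_).trans (hPB l)
        simp only [mem_filter, not_forall, not_not] at hz
        obtain ⟨hz, l', hz'⟩ := hz
        obtain rfl := hown l' l z hz' (Or.inr hz)
        exact mem_filter.2 ⟨List.mem_toFinset.2 hz', hz⟩
      · rw [card_eq_zero.2]
        · omega
        rw [filter_eq_empty_iff]
        intro z hz
        simp only [not_forall, not_not, not_exists]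
        intro l hzl
        rcases hPm l z hzl with hz' | hz'
        · exact Finset.disjoint_left.1 (hC _ _ fun e => h1 ⟨l, e⟩) hz' hz
        · exact Finset.disjoint_left.1 (hC _ _ fun e => h2 ⟨l, e⟩) hz' hz
    have := card_filter_add_card_filter_not (s := C j) (fun z => ∀ l, z ∉ P₁ l ++ P₂ l ++ P₃ l)
    rw [hCs] at this
    change 4 * h ≤ #{z ∈ C j | ∀ l, z ∉ P₁ l ++ P₂ l ++ P₃ l}
    omega
  obtain ⟨k, rfl⟩ : ∃ k', k = k' + 1 := ⟨k - 1, by omega⟩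
  let φ : ℕ → Fin (k + 1) := fun n => ⟨n % (k + 1), Nat.mod_lt _ (by omega)⟩
  have hφ : ∀ n < k + 1, ∀ n' < k + 1, n ≠ n' → φ n ≠ φ n' := by
    intro n hn n' hn' hnn e
    have := congrArg Fin.val e
    simp only [φ, Nat.mod_eq_of_lt hn, Nat.mod_eq_of_lt hn'] at this
    exact hnn this
  have hlink : ∀ n < k + 1, ∀ F : Finset V, #F ≤ (k + 1) * Fintype.card J →
      ∃ t : V × V × List V, (t.1 ∈ P₃ (φ n) ∧ t.2.1 ∈ P₁ (φ (n + 1)) ∧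
        (t.1 :: t.2.2 ++ [t.2.1]).IsChain H.Adj ∧ t.2.2.Nodup ∧ ∀ z ∈ t.2.2, ∃ j, z ∈ Z j) ∧
        #t.2.2.toFinset ≤ Fintype.card J ∧ Disjoint t.2.2.toFinset F := by
    intro n _ F hF
    -- Earlier links use at most `2 * h` vertices altogether, so `2 * h` reserved vertices of each
    -- cluster remain for this one.
    have hF' : #F ≤ 2 * h := hF.trans ((Nat.mul_le_mul_right _ hkJ).trans hJ)
    obtain ⟨w, hw⟩ : ∃ w : Γ.Walk (g (φ n)) (f (φ (n + 1))), w.IsPath := by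
      obtain ⟨w⟩ := (hfg (φ n)).symm.reachable.trans (hconn (φ n) (φ (n + 1)))
      exact ⟨w.toPath, w.toPath.2⟩
    obtain ⟨x, hx, y, hy, K, hK, hKn, hKZ, hKl⟩ := exists_link (Z := fun j => Z j \ F) hC hΓ
      (fun j => sdiff_subset.trans (hZC j))
      (fun j => by have := le_card_sdiff F (Z j); have := hZc j; omega) w hw
      (T := {z ∈ (P₁ (φ (n + 1))).toFinset | z ∈ C (f (φ (n + 1)))})
      (fun z hz => (mem_filter.1 hz).2) (hP₁ _) (hfg (φ n))
      (S := {z ∈ (P₃ (φ n)).toFinset | z ∈ C (f (φ n))})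
      (fun z hz => (mem_filter.1 hz).2) (hP₃ _)
    have hwl := hw.length_lt
    refine ⟨(x, y, K), ⟨?_, ?_, hK, hKn, ?_⟩, ?_, ?_⟩
    · exact List.mem_toFinset.1 (mem_filter.1 hx).1
    · exact List.mem_toFinset.1 (mem_filter.1 hy).1
    · intro z hz
      obtain ⟨v, -, hv⟩ := hKZ z hz
      exact ⟨v, (mem_sdiff.1 hv).1⟩
    · exact (List.toFinset_card_le _).trans (hKl.trans hwl.le)
    · rw [Finset.disjoint_left]
      intro z hz
      obtain ⟨v, -, hv⟩ := hKZ z (List.mem_toFinset.1 hz)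
      exact (mem_sdiff.1 hv).2
  obtain ⟨z₀⟩ : Nonempty V := by
    have : 0 < #(C (f 0)) := by rw [hCs]; omega
    exact ⟨(card_pos.1 this).choose⟩
  have : Nonempty (V × V × List V) := ⟨(z₀, z₀, [])⟩
  obtain ⟨t, ht, htd⟩ := exists_disjoint_choice _ _ hlink
  have hPd : ∀ l l', l ≠ l' → List.Disjoint (P₁ l ++ P₂ l ++ P₃ l) (P₁ l' ++ P₂ l' ++ P₃ l') :=
    fun l l' hll z hz hz' => hll (hown l l' z hz (hPm l' z hz'))
  refine exists_cycle_of_links (q := 2 * s - 12 * h) (by omega) (fun n => P₁ (φ n))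
    (fun n => P₂ (φ n)) (fun n => P₃ (φ n)) (fun n => (t n).2.2) (fun n => (t n).1)
    (fun n => (t n).2.1) ?_ (fun n _ => hPc _) (fun n _ => hPn _) ?_ ?_ (fun n hn => (ht n hn).1)
    (fun n hn => (ht n hn).2.1) (fun n hn => (ht n hn).2.2.1) (fun n hn => (ht n hn).2.2.2.1) ?_ ?_
  · have : φ (k + 1) = φ 0 := by simp [φ]
    simp only [this]
  · exact fun n hn n' hn' hnn => hPd _ _ (hφ n hn n' hn' hnn)
  · intro n _
    rw [hPl]
    omega
  · intro n hn n' hn' z hz hz'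
    obtain ⟨j, hj⟩ := (ht n hn).2.2.2.2 z hz
    exact (mem_filter.1 hj).2 _ hz'
  · intro n hn n' hn' hnn z hz hz'
    exact Finset.disjoint_left.1 (htd n hn n' hn' hnn) (List.mem_toFinset.2 hz)
      (List.mem_toFinset.2 hz')

end SimpleGraph

end CycleOfMatching

/-! ### The cluster graph and its degrees. -/

section ClusterGraph

open Finset
open scoped Classical

/-- The bipartite graph on two copies of `ι`, restricted to `I` and `J`, with edges given by `p`. -/
def bipartiteOn {ι : Type*} (I J : Finset ι) (p : ι → ι → Prop) : SimpleGraph (ι ⊕ ι) where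
  Adj u v := ∃ i ∈ I, ∃ j ∈ J, p i j ∧ (u = .inl i ∧ v = .inr j ∨ u = .inr j ∧ v = .inl i)
  symm := ⟨fun _ _ ⟨i, hi, j, hj, hp, h⟩ => ⟨i, hi, j, hj, hp, h.symm.imp And.symm And.symm⟩⟩
  loopless := ⟨fun _ ⟨i, hi, j, hj, hp, h⟩ => by rcases h with ⟨rfl, h⟩ | ⟨rfl, h⟩ <;> cases h⟩

variable {V ι : Type*} {X Y : Finset V} {s h : ℕ} {A B : ι → Finset V}

lemma EqualParts.disjoint_clusters (P : EqualParts X Y s A B) (hXY : Disjoint X Y) (u v : ι ⊕ ι)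
    (huv : u ≠ v) : Disjoint (Sum.elim A B u) (Sum.elim A B v) := by
  rcases u with i | i <;> rcases v with j | j
  · exact P.disjA i j fun e => huv (by rw [e])
  · exact hXY.mono (P.subA i) (P.subB j)
  · exact hXY.symm.mono (P.subB i) (P.subA j)
  · exact P.disjB i j fun e => huv (by rw [e])

lemma exists_cycle_of_cluster_matching [Fintype ι] (P : EqualParts X Y s A B) (hXY : Disjoint X Y)
    (H : SimpleGraph V) {I J : Finset ι} {k : ℕ}
    (M : (bipartiteOn I J fun i j => HoleFree h H.Adj (A i) (B j)).HasConnectedMatching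
      (I.map .inl) (J.map .inr) k) (hk : 0 < k) (hs : 8 * h ≤ s)
    (hm : 2 * (Fintype.card ι * Fintype.card ι) ≤ h) :
    ∃ N, k * (2 * s - 12 * h) ≤ N ∧ HasCycleOfOrder H N := by
  refine SimpleGraph.exists_cycle_of_hasConnectedMatching ?_ M hk (P.disjoint_clusters hXY) ?_ ?_
    hs ?_
  · rw [Finset.disjoint_left]
    intro u hu hu'
    obtain ⟨i, -, rfl⟩ := mem_map.1 hu
    obtain ⟨j, -, hj⟩ := mem_map.1 hu'
    cases hj
  · rintro (i | i)
    exacts [P.cardA i, P.cardB i]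
  · rintro _ _ ⟨i, -, j, -, hp, ⟨rfl, rfl⟩ | ⟨rfl, rfl⟩⟩
    · exact hp
    · intro S hS T hT hS' hT'
      obtain ⟨a, ha, b, hb, hab⟩ := hp T hT S hS hT' hS'
      exact ⟨b, hb, a, ha, hab.symm⟩
  · rw [Fintype.card_sum]
    nlinarith

lemma exists_mono_cycle_of_clusters [Fintype ι] (P : EqualParts X Y s A B) (hXY : Disjoint X Y)
    (r : Bool → SimpleGraph V) {I J : Finset ι} {n d k : ℕ} (hI : #I = n) (hJ : #J = n)
    (hn : 0 < n)
    (degI : ∀ i ∈ I, d ≤ #{j ∈ J | ∃ c, HoleFree h (r c).Adj (A i) (B j)})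
    (degJ : ∀ j ∈ J, d ≤ #{i ∈ I | ∃ c, HoleFree h (r c).Adj (A i) (B j)}) (hk : 0 < k)
    (hkd : 2 * k ≤ d ∨ (2 * k ≤ n ∧ k + n ≤ 2 * d ∧ 2 * n < 3 * d)) (hs : 8 * h ≤ s)
    (hm : 2 * (Fintype.card ι * Fintype.card ι) ≤ h) :
    ∃ N, k * (2 * s - 12 * h) ≤ N ∧ HasMonoCycleOfOrder (r true) (r false) N := by
  let Γ : Bool → SimpleGraph (ι ⊕ ι) := fun c =>
    bipartiteOn I J fun i j => HoleFree h (r c).Adj (A i) (B j)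
  have hΓ : ∀ c u v, (Γ c).Adj u v → (u ∈ I.map .inl ∧ v ∈ J.map .inr) ∨
      (u ∈ J.map .inr ∧ v ∈ I.map .inl) := by
    rintro c _ _ ⟨i, hi, j, hj, -, ⟨rfl, rfl⟩ | ⟨rfl, rfl⟩⟩
    · exact Or.inl ⟨mem_map_of_mem _ hi, mem_map_of_mem _ hj⟩
    · exact Or.inr ⟨mem_map_of_mem _ hj, mem_map_of_mem _ hi⟩
  have hdisj : Disjoint (I.map (.inl : ι ↪ ι ⊕ ι)) (J.map .inr) := by
    rw [Finset.disjoint_left]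
    intro u hu hu'
    obtain ⟨i, -, rfl⟩ := mem_map.1 hu
    obtain ⟨j, -, hj⟩ := mem_map.1 hu'
    cases hj
  have M := exists_mono_connectedMatching (R := Γ true) (B := Γ false) (d := d) hdisj
    (hΓ true) (hΓ false) (by rw [card_map, hI]) (by rw [card_map, hJ]) hn ?_ ?_ hk hkd
  · rcases M with M | M
    · obtain ⟨N, hN, hc⟩ := exists_cycle_of_cluster_matching P hXY _ M hk hs hm
      exact ⟨N, hN, Or.inl hc⟩
    · obtain ⟨N, hN, hc⟩ := exists_cycle_of_cluster_matching P hXY _ M hk hs hm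
      exact ⟨N, hN, Or.inr hc⟩
  · intro u hu
    obtain ⟨i, hi, rfl⟩ := mem_map.1 hu
    refine (degI i hi).trans (card_le_card_of_injOn Sum.inr ?_ fun _ _ _ _ h => Sum.inr.inj h)
    intro j hj
    simp only [coe_filter, Set.mem_ofPred_eq] at hj
    obtain ⟨hj, c, hc⟩ := hj
    simp only [coe_filter, Set.mem_ofPred_eq]
    refine ⟨mem_map_of_mem _ hj, ?_⟩
    cases c
    · exact Or.inr ⟨i, hi, j, hj, hc, Or.inl ⟨rfl, rfl⟩⟩
    · exact Or.inl ⟨i, hi, j, hj, hc, Or.inl ⟨rfl, rfl⟩⟩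
  · intro u hu
    obtain ⟨j, hj, rfl⟩ := mem_map.1 hu
    refine (degJ j hj).trans (card_le_card_of_injOn Sum.inl ?_ fun _ _ _ _ h => Sum.inl.inj h)
    intro i hi
    simp only [coe_filter, Set.mem_ofPred_eq] at hi
    obtain ⟨hi, c, hc⟩ := hi
    simp only [coe_filter, Set.mem_ofPred_eq]
    refine ⟨mem_map_of_mem _ hi, ?_⟩
    cases c
    · exact Or.inr ⟨i, hi, j, hj, hc, Or.inr ⟨rfl, rfl⟩⟩
    · exact Or.inl ⟨i, hi, j, hj, hc, Or.inr ⟨rfl, rfl⟩⟩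

/-- Most fibers of a small set are small. -/
lemma card_large_fibers_le {κ τ : Type*} [Fintype κ] (E : Finset τ) (f : τ → κ) {γ : ℝ}
    (hγ : 0 < γ) (hm : 0 < Fintype.card κ) (hE : (#E : ℝ) ≤ 2 * γ ^ 2 * (Fintype.card κ : ℝ) ^ 2) :
    (1 - 2 * γ) * Fintype.card κ ≤ #{i | (#{p ∈ E | f p = i} : ℝ) ≤ γ * Fintype.card κ} := by
  have hm' : (0 : ℝ) < Fintype.card κ := by exact_mod_cast hm
  have hsum := card_eq_sum_card_fiberwise (s := E) (f := f) (t := univ)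
    fun _ _ => mem_coe.2 (mem_univ _)
  have hle : (#{i | ¬ (#{p ∈ E | f p = i} : ℝ) ≤ γ * Fintype.card κ} : ℝ) *
      (γ * Fintype.card κ) ≤ #E := by
    rw [hsum, ← nsmul_eq_mul]
    push_cast
    refine le_trans ?_ (sum_le_sum_of_subset_of_nonneg (filter_subset
      (fun i => ¬ (#{p ∈ E | f p = i} : ℝ) ≤ γ * Fintype.card κ) _)
      fun _ _ _ => Nat.cast_nonneg _)
    refine card_nsmul_le_sum _ _ _ fun i hi => ?_
    exact (not_le.1 (mem_filter.1 hi).2).le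
  have hadd := card_filter_add_card_filter_not (s := (univ : Finset κ))
    (fun i => (#{p ∈ E | f p = i} : ℝ) ≤ γ * Fintype.card κ)
  rw [card_univ] at hadd
  have hadd' : (#{i | (#{p ∈ E | f p = i} : ℝ) ≤ γ * Fintype.card κ} : ℝ) +
      #{i | ¬ (#{p ∈ E | f p = i} : ℝ) ≤ γ * Fintype.card κ} = Fintype.card κ := by
    exact_mod_cast hadd
  have : (#{i | ¬ (#{p ∈ E | f p = i} : ℝ) ≤ γ * Fintype.card κ} : ℝ) ≤ 2 * γ * Fintype.card κ := by
    refine le_of_mul_le_mul_right (hle.trans (hE.trans_eq ?_)) (mul_pos hγ hm')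
    ring
  linarith

/-- A vertex of large degree has neighbors in many parts. -/
lemma EqualParts.le_card_touched [Fintype ι] (P : EqualParts X Y s A B) {n : ℕ} (hY : #Y = n)
    {δ η : ℝ} (hcov : (1 - η) * n ≤ (Fintype.card ι * s : ℕ)) (hs : 0 < s) (hδ : η ≤ δ)
    (p : V → Prop) (hp : δ * n ≤ #{y ∈ Y | p y}) :
    (δ - η) * Fintype.card ι ≤ #{j | ∃ y ∈ B j, p y} := by
  have hs' : (0 : ℝ) < s := by exact_mod_cast hs
  have hsub : ({y ∈ Y | p y} : Finset V) ⊆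
      (Y \ univ.biUnion B) ∪ (univ.filter fun j => ∃ y ∈ B j, p y).biUnion B := by
    intro y hy
    rw [mem_filter] at hy
    simp only [mem_union, mem_sdiff, mem_biUnion, mem_univ, true_and, mem_filter]
    by_cases h : ∃ j, y ∈ B j
    · obtain ⟨j, hj⟩ := h
      exact Or.inr ⟨j, ⟨y, hj, hy.2⟩, hj⟩
    · exact Or.inl ⟨hy.1, h⟩
  have h1 := (card_le_card hsub).trans (card_union_le _ _)
  have h2 : #((univ.filter fun j => ∃ y ∈ B j, p y).biUnion B) ≤
      #{j | ∃ y ∈ B j, p y} * s := card_biUnion_le_card_mul _ _ _ fun j _ => (P.cardB j).le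
  have hBY : univ.biUnion B ⊆ Y := biUnion_subset.2 fun j _ => P.subB j
  have h3 := card_sdiff_add_card_eq_card hBY
  rw [P.swap.card_biUnionA, hY] at h3
  have h4 : (#{y ∈ Y | p y} : ℝ) + (Fintype.card ι * s : ℕ) ≤ n + #{j | ∃ y ∈ B j, p y} * s := by
    have : #{y ∈ Y | p y} + Fintype.card ι * s ≤ n + #{j | ∃ y ∈ B j, p y} * s := by omega
    exact_mod_cast this
  have h5 : ((Fintype.card ι * s : ℕ) : ℝ) ≤ n := by
    have : Fintype.card ι * s ≤ n := by omega
    exact_mod_cast this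
  push_cast at h4 h5 hcov
  refine le_of_mul_le_mul_right ?_ hs'
  have : (δ - η) * (Fintype.card ι * s) ≤ (δ - η) * n :=
    mul_le_mul_of_nonneg_left h5 (by linarith)
  nlinarith

end ClusterGraph

/-! ### The lower bound, with explicit losses. -/

section LowerBound

open Finset
open scoped Classical

/-- The role is a degree bound in the cluster graph: of the touched parts `T`, those in bad pairs
(`E`) and those discarded (outside `I`) are lost, and `η + γ + 2 * γ ≤ 4 * γ`. -/
lemma le_card_of_subset_union {κ : Type*} [Fintype κ] {T W E I : Finset κ} {δ γ η : ℝ}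
    (hsub : T ⊆ W ∪ E ∪ Iᶜ) (hT : (δ - η) * Fintype.card κ ≤ #T)
    (hE : (#E : ℝ) ≤ γ * Fintype.card κ) (hI : (1 - 2 * γ) * Fintype.card κ ≤ #I)
    (hη : η ≤ γ) : ⌈(δ - 4 * γ) * Fintype.card κ⌉₊ ≤ #W := by
  rw [Nat.ceil_le]
  have h1 := (card_le_card hsub).trans ((card_union_le _ _).trans
    (Nat.add_le_add_right (card_union_le _ _) _))
  have h2 := card_add_card_compl I
  have h3 : (#T : ℝ) + #I ≤ #W + #E + Fintype.card κ := by
    have : #T + #I ≤ #W + #E + Fintype.card κ := by omega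
    exact_mod_cast this
  have : η * Fintype.card κ ≤ γ * Fintype.card κ := by gcongr
  linarith

lemma circBound_le_of_lt {δ : ℝ} (hδ : 2 / 3 < δ) : circBound δ ≤ 1 ∧ circBound δ ≤ 4 * δ - 2 := by
  rw [circBound, if_neg hδ.not_ge]
  split_ifs <;> constructor <;> linarith

lemma le_circBound {δ : ℝ} (hδ : δ ≤ 1) : δ ≤ circBound δ := by
  rw [circBound]
  split_ifs <;> linarith

lemma circBound_le_one {δ : ℝ} : circBound δ ≤ 1 := by
  rw [circBound]
  split_ifs <;> linarith

/-- The size of the connected matching in the cluster graph. -/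
lemma exists_matching_size {δ γ : ℝ} (hγ : 0 < γ) (hγδ : 20 * γ ≤ δ)
    (hγδ' : 2 / 3 < δ → 8 * γ ≤ δ - 2 / 3) {m n d : ℕ} (hm : 1 ≤ γ * m) (hnm : n ≤ m)
    (hn : (1 - 2 * γ) * m ≤ n) (hγ1 : γ ≤ 1 / 20) (hd : (δ - 4 * γ) * m ≤ d) :
    ∃ k, 0 < k ∧ (2 * k ≤ d ∨ (2 * k ≤ n ∧ k + n ≤ 2 * d ∧ 2 * n < 3 * d)) ∧
      (circBound δ - 17 * γ) * m ≤ 2 * k := by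
  have hnm' : (n : ℝ) ≤ m := by exact_mod_cast hnm
  have hm0 : (0 : ℝ) ≤ m := Nat.cast_nonneg _
  have hd2 : 2 ≤ d := by
    have : (2 : ℝ) ≤ d := by nlinarith
    exact_mod_cast this
  rcases le_or_gt δ (2 / 3) with h | h
  · refine ⟨d / 2, by omega, Or.inl (by omega), ?_⟩
    have : (d : ℝ) ≤ 2 * (d / 2 : ℕ) + 1 := by
      have : d ≤ 2 * (d / 2) + 1 := by omega
      exact_mod_cast this
    rw [circBound, if_pos h]
    nlinarith
  · obtain ⟨hf1, hf2⟩ := circBound_le_of_lt h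
    have h8 := hγδ' h
    have h3 : 2 * n < 3 * d := by
      have : (2 * n : ℝ) < 3 * d := by nlinarith
      exact_mod_cast this
    have hn2 : 2 ≤ n := by
      have : (2 : ℝ) ≤ n := by nlinarith
      exact_mod_cast this
    -- Twice this is about `min n (4 * d - 2 * n)`, which produces the pieces `1` and `4 * δ - 2`.
    refine ⟨min (n / 2) (2 * d - n), by omega, Or.inr ⟨by omega, by omega, h3⟩, ?_⟩
    rcases min_choice (n / 2) (2 * d - n) with e | e <;> rw [e]
    · have : (n : ℝ) ≤ 2 * (n / 2 : ℕ) + 1 := by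
        have : n ≤ 2 * (n / 2) + 1 := by omega
        exact_mod_cast this
      nlinarith
    · rw [Nat.cast_sub (by omega)]
      push_cast
      nlinarith

/-- The loss `30 * γ` consists of `17 * γ` from the matching, `12 * γ` from the path ends and
reserves, and at most `γ` from vertices outside the parts. -/
lemma cycle_bound {f γ : ℝ} (hγ : 0 < γ) (hγ1 : γ ≤ 1 / 20) (hδf : 20 * γ ≤ f) (hf1 : f ≤ 1)
    {n m s k h : ℕ} (hcov : (1 - γ ^ 2) * n ≤ (m : ℝ) * s) (hkl : (f - 17 * γ) * m ≤ 2 * k)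
    (hceil : (h : ℝ) ≤ 2 * (γ * s)) : (f - 30 * γ) * n ≤ (k : ℝ) * (2 * s - 12 * h) := by
  have hn0 : (0 : ℝ) ≤ n := Nat.cast_nonneg _
  have hs' : (0 : ℝ) ≤ s := Nat.cast_nonneg _
  calc (f - 30 * γ) * n
      ≤ (f - 17 * γ) * ((1 - 12 * γ) * ((1 - γ ^ 2) * n)) := by
        rw [← mul_assoc, ← mul_assoc]
        refine mul_le_mul_of_nonneg_right ?_ hn0
        have : (1 - 13 * γ) ≤ (1 - 12 * γ) * (1 - γ ^ 2) := by nlinarith [sq_nonneg γ]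
        have : (f - 17 * γ) * (1 - 13 * γ) ≤
          (f - 17 * γ) * ((1 - 12 * γ) * (1 - γ ^ 2)) :=
          mul_le_mul_of_nonneg_left this (by linarith)
        nlinarith
    _ ≤ (f - 17 * γ) * ((1 - 12 * γ) * (m * s)) := by
        refine mul_le_mul_of_nonneg_left ?_ (by linarith)
        exact mul_le_mul_of_nonneg_left hcov (by linarith)
    _ = ((f - 17 * γ) * m) * (s * (1 - 12 * γ)) := by ring
    _ ≤ (2 * k) * (s * (1 - 12 * γ)) :=
        mul_le_mul_of_nonneg_right hkl (mul_nonneg hs' (by linarith))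
    _ = k * (2 * s - 12 * (2 * (γ * s))) := by ring
    _ ≤ k * (2 * s - 12 * h) := by gcongr

universe u

lemma exists_mono_cycle_of_parts {V : Type u} {X Y : Finset V} (hXY : Disjoint X Y) {n : ℕ}
    (hX : #X = n) (hY : #Y = n) (r : Bool → SimpleGraph V) {δ γ : ℝ} (hγ : 0 < γ)
    (hγδ : 20 * γ ≤ δ) (hγδ' : 2 / 3 < δ → 8 * γ ≤ δ - 2 / 3) (hγ1 : γ ≤ 1 / 20)
    (degX : ∀ x ∈ X, δ * n ≤ #{y ∈ Y | ∃ c, (r c).Adj x y})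
    (degY : ∀ y ∈ Y, δ * n ≤ #{x ∈ X | ∃ c, (r c).Adj x y})
    {ι : Type*} [Fintype ι] {s : ℕ} {A B : ι → Finset V} (P : EqualParts X Y s A B)
    (hcov : (1 - γ ^ 2) * n ≤ (Fintype.card ι * s : ℕ)) (hm : 1 ≤ γ * Fintype.card ι)
    (hs : 1 ≤ γ * s) (hms : 2 * ((Fintype.card ι : ℝ) * Fintype.card ι) ≤ γ * s)
    (hbad : ∀ c, (#(EqualParts.badPairs A B ⌈γ * s⌉₊ (r c).Adj) : ℝ) ≤
      γ ^ 2 * (Fintype.card ι : ℝ) ^ 2) :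
    ∃ N, (circBound δ - 30 * γ) * n ≤ (N : ℕ) ∧ HasMonoCycleOfOrder (r true) (r false) N := by
  have hm0 : 0 < Fintype.card ι := by
    by_contra! h
    rw [Nat.le_zero.1 h] at hm
    norm_num at hm
  have hs0 : 0 < s := by
    by_contra! h
    rw [Nat.le_zero.1 h] at hs
    norm_num at hs
  have hη : γ ^ 2 ≤ γ := by nlinarith
  have hγδ₁ : γ ≤ δ := by linarith
  let E : Finset (ι × ι) := univ.biUnion fun c => EqualParts.badPairs A B ⌈γ * s⌉₊ (r c).Adj
  have hE : (#E : ℝ) ≤ 2 * γ ^ 2 * (Fintype.card ι : ℝ) ^ 2 := by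
    have h1 : #E ≤ ∑ c, #(EqualParts.badPairs A B ⌈γ * s⌉₊ (r c).Adj) := card_biUnion_le
    have h2 : (#E : ℝ) ≤ ∑ c, (#(EqualParts.badPairs A B ⌈γ * s⌉₊ (r c).Adj) : ℝ) := by
      exact_mod_cast h1
    rw [Fintype.sum_bool] at h2
    linarith [hbad true, hbad false]
  have hfree : ∀ i j c, (i, j) ∉ E → ∀ x ∈ A i, ∀ y ∈ B j, (r c).Adj x y →
      HoleFree ⌈γ * s⌉₊ (r c).Adj (A i) (B j) := by
    intro i j c hij x hx y hy hxy
    by_contra hno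
    refine hij (mem_biUnion.2 ⟨c, mem_univ _, ?_⟩)
    simp only [EqualParts.badPairs, mem_filter, mem_univ, true_and]
    exact ⟨fun h => h x hx y hy hxy, hno⟩
  have hI₀ := card_large_fibers_le E Prod.fst hγ hm0 hE
  have hJ₀ := card_large_fibers_le E Prod.snd hγ hm0 hE
  generalize hI₀' : ({i | (#{p ∈ E | p.1 = i} : ℝ) ≤ γ * Fintype.card ι} : Finset ι) = I₀ at hI₀
  generalize hJ₀' : ({i | (#{p ∈ E | p.2 = i} : ℝ) ≤ γ * Fintype.card ι} : Finset ι) = J₀ at hJ₀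
  -- The two sets of good parts are trimmed to the same size, as the matching theorem needs a
  -- balanced graph.
  obtain ⟨I, hII, hI⟩ := exists_subset_card_eq (min_le_left #I₀ #J₀)
  obtain ⟨J, hJJ, hJ⟩ := exists_subset_card_eq (min_le_right #I₀ #J₀)
  have hcard : (1 - 2 * γ) * Fintype.card ι ≤ (min #I₀ #J₀ : ℕ) := by
    rcases min_choice #I₀ #J₀ with e | e <;> rw [e] <;> assumption
  generalize min #I₀ #J₀ = n' at hI hJ hcard
  have hn'm : n' ≤ Fintype.card ι := hI ▸ card_le_univ I
  obtain ⟨k, hk, hkd, hkl⟩ := exists_matching_size hγ hγδ hγδ' hm hn'm hcard hγ1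
    (Nat.le_ceil ((δ - 4 * γ) * Fintype.card ι))
  have hn'0 : 0 < n' := by
    have hm0' : (0 : ℝ) < Fintype.card ι := by exact_mod_cast hm0
    have : (0 : ℝ) < n' := lt_of_lt_of_le (by nlinarith) hcard
    exact_mod_cast this
  have hceil : (⌈γ * s⌉₊ : ℝ) ≤ 2 * (γ * s) := by
    have := Nat.ceil_lt_add_one (a := γ * s) (by positivity)
    linarith
  have hs' : (0 : ℝ) ≤ s := Nat.cast_nonneg _
  have h12 : 12 * ⌈γ * s⌉₊ ≤ 2 * s := by
    have : (12 * ⌈γ * s⌉₊ : ℝ) ≤ 2 * s := by nlinarith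
    exact_mod_cast this
  have hcyc := exists_mono_cycle_of_clusters (h := ⌈γ * s⌉₊) P hXY r hI hJ hn'0 ?_ ?_ hk
    hkd ?_ ?_
  · obtain ⟨N, hN, hc⟩ := hcyc
    refine ⟨N, ?_, hc⟩
    have hN' : (k : ℝ) * (2 * s - 12 * ⌈γ * s⌉₊) ≤ N := by
      have : ((k * (2 * s - 12 * ⌈γ * s⌉₊) : ℕ) : ℝ) ≤ N := by exact_mod_cast hN
      rw [Nat.cast_mul, Nat.cast_sub h12] at this
      push_cast at this
      exact this
    refine le_trans ?_ hN'
    have hδf : 20 * γ ≤ circBound δ := hγδ.trans (le_circBound ?_)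
    · have hf1 := circBound_le_one (δ := δ)
      exact cycle_bound hγ hγ1 hδf hf1 (by exact_mod_cast hcov) hkl hceil
    · obtain ⟨i⟩ : Nonempty ι := Fintype.card_pos_iff.1 hm0
      obtain ⟨x, hx⟩ := card_pos.1 (hs0.trans_eq (P.cardA i).symm)
      have h1 := degX x (P.subA i hx)
      have h2 : (#{y ∈ Y | ∃ c, (r c).Adj x y} : ℝ) ≤ n := by
        exact_mod_cast hY ▸ card_filter_le Y _
      have h3 : (0 : ℝ) < n := by
        have : 0 < n := hX ▸ card_pos.2 ⟨x, P.subA i hx⟩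
        exact_mod_cast this
      by_contra! h
      nlinarith
  · intro i hi
    -- A single vertex of the part suffices: one edge shows that a pair is not edgeless, and if the
    -- pair is not bad it is then free of holes in that color.
    obtain ⟨x, hx⟩ := card_pos.1 (hs0.trans_eq (P.cardA i).symm)
    refine le_card_of_subset_union (E := univ.filter fun j => (i, j) ∈ E) (I := J) ?_
      (P.le_card_touched hY hcov hs0 (hη.trans hγδ₁) (fun y => ∃ c, (r c).Adj x y)
        (by convert degX x (P.subA i hx))) ?_ (by rwa [hJ]) hη
    · intro j hj
      simp only [mem_filter, mem_univ, true_and] at hj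
      obtain ⟨y, hy, c, hxy⟩ := hj
      simp only [mem_union, mem_filter, mem_univ, true_and, mem_compl]
      by_cases h1 : (i, j) ∈ E
      · exact Or.inl (Or.inr h1)
      by_cases h2 : j ∈ J
      · exact Or.inl (Or.inl ⟨h2, c, hfree i j c h1 x hx y hy hxy⟩)
      · exact Or.inr h2
    · have := hII hi
      rw [← hI₀', mem_filter] at this
      refine le_trans ?_ this.2
      exact_mod_cast card_le_card_of_injOn (fun j => (i, j))
        (fun j hj => by simpa using hj) fun _ _ _ _ h => (Prod.mk.inj h).2
  · intro j hj
    obtain ⟨y, hy⟩ := card_pos.1 (hs0.trans_eq (P.cardB j).symm)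
    refine le_card_of_subset_union (E := univ.filter fun i => (i, j) ∈ E) (I := I) ?_
      (P.swap.le_card_touched hX hcov hs0 (hη.trans hγδ₁) (fun x => ∃ c, (r c).Adj x y)
        (by convert degY y (P.subB j hy))) ?_
      (by rwa [hI]) hη
    · intro i hi
      simp only [mem_filter, mem_univ, true_and] at hi
      obtain ⟨x, hx, c, hxy⟩ := hi
      simp only [mem_union, mem_filter, mem_univ, true_and, mem_compl]
      by_cases h1 : (i, j) ∈ E
      · exact Or.inl (Or.inr h1)
      by_cases h2 : i ∈ I
      · exact Or.inl (Or.inl ⟨h2, c, hfree i j c h1 x hx y hy hxy⟩)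
      · exact Or.inr h2
    · have := hJJ hj
      rw [← hJ₀', mem_filter] at this
      refine le_trans ?_ this.2
      exact_mod_cast card_le_card_of_injOn (fun i => (i, j))
        (fun i hi => by simpa using hi) fun _ _ _ _ h => (Prod.mk.inj h).1
  · have : (8 * ⌈γ * s⌉₊ : ℝ) ≤ s := by nlinarith
    exact_mod_cast this
  · have : (2 * ((Fintype.card ι : ℝ) * Fintype.card ι)) ≤ ⌈γ * s⌉₊ := hms.trans (Nat.le_ceil _)
    exact_mod_cast this

theorem exists_mono_cycle {δ ε : ℝ} (hδ : 0 < δ) (hε : 0 < ε) :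
    ∃ n₀ : ℕ, ∀ n, n₀ ≤ n → ∀ (V : Type u) (X Y : Finset V), Disjoint X Y → #X = n → #Y = n →
      ∀ r : Bool → SimpleGraph V, (∀ x ∈ X, δ * n ≤ #{y ∈ Y | ∃ c, (r c).Adj x y}) →
        (∀ y ∈ Y, δ * n ≤ #{x ∈ X | ∃ c, (r c).Adj x y}) →
        ∃ N : ℕ, (circBound δ - ε) * n ≤ N ∧ HasMonoCycleOfOrder (r true) (r false) N := by
  obtain ⟨γ, hγ, hγδ, hγδ', hγ1, hγε⟩ : ∃ γ : ℝ, 0 < γ ∧ 20 * γ ≤ δ ∧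
      (2 / 3 < δ → 8 * γ ≤ δ - 2 / 3) ∧ γ ≤ 1 / 20 ∧ 30 * γ ≤ ε := by
    have h1 : (0 : ℝ) < min (min (δ / 20) (1 / 20)) (ε / 30) := by positivity
    have h2 := min_le_left (min (δ / 20) (1 / 20)) (ε / 30)
    have h3 := min_le_right (min (δ / 20) (1 / 20)) (ε / 30)
    have h4 := min_le_left (δ / 20) (1 / 20)
    have h5 := min_le_right (δ / 20) (1 / 20)
    rcases le_or_gt δ (2 / 3) with h | h
    · exact ⟨_, h1, by linarith, fun h' => by linarith, by linarith, by linarith⟩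
    · have h6 : 0 < (δ - 2 / 3) / 8 := by linarith
      have h7 := min_le_left (min (min (δ / 20) (1 / 20)) (ε / 30)) ((δ - 2 / 3) / 8)
      have h8 := min_le_right (min (min (δ / 20) (1 / 20)) (ε / 30)) ((δ - 2 / 3) / 8)
      exact ⟨_, lt_min h1 h6, by linarith, fun h' => by linarith, by linarith, by linarith⟩
  obtain ⟨m₀, hm₀⟩ := exists_nat_ge (1 / γ)
  rw [div_le_iff₀ hγ] at hm₀
  obtain ⟨L, N₀, hreg⟩ := EqualParts.exists_regular.{u} (η := γ ^ 2) (ε := γ) (by positivity) hγ m₀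
  obtain ⟨S, hS⟩ := exists_nat_ge ((1 + 2 * ((L : ℝ) * L)) / γ)
  rw [div_le_iff₀ hγ] at hS
  refine ⟨max N₀ (2 * (L * S)), fun n hn V X Y hXY hX hY r degX degY => ?_⟩
  obtain ⟨ι, _, s, A, B, P, hmι, hLι, hcov, hbad⟩ := hreg n ((le_max_left _ _).trans hn) V X Y hX hY
    fun c => (r c).Adj
  have hLι' : (Fintype.card ι : ℝ) ≤ L := by exact_mod_cast hLι
  have hmι' : (m₀ : ℝ) ≤ Fintype.card ι := by exact_mod_cast hmι
  have hm : 1 ≤ γ * Fintype.card ι := by nlinarith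
  have hcL : (0 : ℝ) < L := by
    have : (0 : ℝ) < Fintype.card ι := by
      by_contra! h
      nlinarith
    linarith
  have hSs : (S : ℝ) ≤ s := by
    have hn' : (2 * (L * S) : ℝ) ≤ n := by exact_mod_cast (le_max_right _ _).trans hn
    push_cast at hcov
    have h1 : (Fintype.card ι : ℝ) * s ≤ L * s := by gcongr
    have h2 : (1 / 2 : ℝ) * n ≤ (1 - γ ^ 2) * n := by
      refine mul_le_mul_of_nonneg_right ?_ (Nat.cast_nonneg _)
      nlinarith
    refine le_of_mul_le_mul_left ?_ hcL
    linarith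
  have hSs' : γ * S ≤ γ * s := by gcongr
  have hcc : (Fintype.card ι : ℝ) * Fintype.card ι ≤ L * L := by gcongr
  have hLL : (0 : ℝ) ≤ L * L := by positivity
  obtain ⟨N, hN, hc⟩ := exists_mono_cycle_of_parts hXY hX hY r hγ hγδ hγδ' hγ1 degX degY P hcov hm
    (by linarith) (by linarith) hbad
  refine ⟨N, le_trans ?_ hN, hc⟩
  gcongr

end LowerBound

/-! ### Cycles in blow-ups of colored patterns. -/

section UpperBound

open Finset
open scoped Classical

/-- If the edges of `H` respect a labelling, then a cover with few vertices of each label bounds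
the length of the cycles. -/
lemma le_of_hasCycleOfOrder {V L : Type*} {H : SimpleGraph V} (lab : V → L) {T : Finset V} {t : ℕ}
    (hlab : ∀ u v, H.Adj u v → lab u = lab v) (hT : ∀ u v, H.Adj u v → u ∈ T ∨ v ∈ T)
    (ht : ∀ a, #{v ∈ T | lab v = a} ≤ t) {m : ℕ} (hm : HasCycleOfOrder H m) : m ≤ 2 * t := by
  obtain ⟨v, p, hp, rfl⟩ := hm
  have hsupp : ∀ (u w : V) (q : H.Walk u w), ∀ x ∈ q.support, lab x = lab u := by
    intro u w q
    induction q with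
    | nil => simp
    | cons h q ih =>
      intro x hx
      rcases List.mem_cons.1 hx with rfl | hx
      · rfl
      · rw [ih x hx, hlab _ _ h]
  have hcount : ∀ l : List V, l.Nodup → (∀ x ∈ l, x ∈ p.support) → l.countP (· ∈ T) ≤ t := by
    intro l hl hsub
    rw [List.countP_eq_length_filter, ← List.toFinset_card_of_nodup (hl.filter _)]
    refine (card_le_card fun x hx => ?_).trans (ht (lab v))
    rw [List.mem_toFinset, List.mem_filter] at hx
    exact mem_filter.2 ⟨by simpa using hx.2, hsupp _ _ p x (hsub x hx.1)⟩
  -- Each edge of the cycle has an end in `T`, and each vertex is once a first and once a second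
  -- end. So the length is at most twice the number of cover vertices on the cycle.
  have hle : ∀ D : List H.Dart, D.length ≤ (D.map (·.fst)).countP (· ∈ T) +
      (D.map (·.snd)).countP (· ∈ T) := by
    intro D
    induction D with
    | nil => simp
    | cons d D ih =>
      rw [List.length_cons, List.map_cons, List.map_cons, List.countP_cons, List.countP_cons]
      have := hT _ _ d.adj
      by_cases h1 : d.fst ∈ T <;> by_cases h2 : d.snd ∈ T <;> simp_all <;> omega
  have h := hle p.darts
  rw [p.map_fst_darts, p.map_snd_darts, p.length_darts] at h
  have h1 := hcount _ hp.nodup_dropLast_support fun x hx => List.mem_of_mem_dropLast hx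
  have h2 := hcount _ hp.support_nodup fun x hx => List.mem_of_mem_tail hx
  omega

lemma exists_fibers {ι : Type*} [Fintype ι] {n : ℕ} (z : ι → ℕ) (hz : ∑ i, z i = n) :
    ∃ ty : Fin n → ι, ∀ i, #{x | ty x = i} = z i := by
  have hc : Fintype.card (Σ i, Fin (z i)) = Fintype.card (Fin n) := by simp [hz]
  let e := Fintype.equivOfCardEq hc
  refine ⟨fun x => (e.symm x).1, fun i => ?_⟩
  rw [← Fintype.card_fin (z i), ← card_univ, ← card_map (f := (Function.Embedding.sigmaMk
    (β := fun i => Fin (z i)) i).trans e.toEmbedding)]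
  congr 1
  ext x
  simp only [mem_filter, mem_univ, true_and, mem_map, Function.Embedding.trans_apply,
    Function.Embedding.sigmaMk_apply, Equiv.coe_toEmbedding]
  constructor
  · rintro rfl
    exact ⟨(e.symm x).2, by simp⟩
  · rintro ⟨y, rfl⟩
    simp

lemma card_filter_fibers {ι : Type*} [Fintype ι] {n : ℕ} {z : ι → ℕ} {ty : Fin n → ι}
    (hty : ∀ i, #{x | ty x = i} = z i) (p : ι → Prop) :
    #{x | p (ty x)} = ∑ i, if p i then z i else 0 := by
  rw [card_eq_sum_card_fiberwise (f := ty) (t := univ) fun _ _ => mem_coe.2 (mem_univ _)]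
  refine sum_congr rfl fun i _ => ?_
  split_ifs with h
  · rw [← hty i]
    congr 1
    ext x
    simp only [mem_filter, mem_univ, true_and]
    exact ⟨fun h => h.2, fun h' => ⟨h' ▸ h, h'⟩⟩
  · rw [card_eq_zero, filter_eq_empty_iff]
    rintro x hx rfl
    exact h (mem_filter.1 hx).2

variable {α : Type*} [Fintype α] {E : α → α → Prop}

lemma degree_bipartiteOn_inl (x : α) :
    (bipartiteOn univ univ E).degree (.inl x) = #{y | E x y} := by
  rw [← SimpleGraph.card_neighborFinset_eq_degree,
    ← card_map (Function.Embedding.inr (α := α) (β := α))]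
  congr 1
  ext v
  rw [SimpleGraph.mem_neighborFinset]
  simp only [bipartiteOn, mem_univ, true_and, mem_map, mem_filter]
  constructor
  · rintro ⟨i, j, h, ⟨h1, rfl⟩ | ⟨h1, -⟩⟩
    · cases h1
      exact ⟨j, h, rfl⟩
    · cases h1
  · rintro ⟨j, h, rfl⟩
    exact ⟨x, j, h, Or.inl ⟨rfl, rfl⟩⟩

lemma degree_bipartiteOn_inr (y : α) :
    (bipartiteOn univ univ E).degree (.inr y) = #{x | E x y} := by
  rw [← SimpleGraph.card_neighborFinset_eq_degree,
    ← card_map (Function.Embedding.inl (α := α) (β := α))]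
  congr 1
  ext v
  rw [SimpleGraph.mem_neighborFinset]
  simp only [bipartiteOn, mem_univ, true_and, mem_map, mem_filter]
  constructor
  · rintro ⟨i, j, h, ⟨h1, -⟩ | ⟨h1, rfl⟩⟩
    · cases h1
    · cases h1
      exact ⟨i, h, rfl⟩
  · rintro ⟨i, h, rfl⟩
    exact ⟨i, y, h, Or.inr ⟨rfl, rfl⟩⟩

lemma isBalancedBipartite_bipartiteOn {n : ℕ} (E : Fin n → Fin n → Prop) :
    IsBalancedBipartite (bipartiteOn univ univ E) n := by
  refine ⟨univ.map .inl, univ.map .inr, ⟨?_, ?_⟩, ?_, by simp, by simp⟩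
  · rw [Set.disjoint_left]
    intro u hu hu'
    obtain ⟨i, -, rfl⟩ := mem_map.1 (mem_coe.1 hu)
    obtain ⟨j, -, hj⟩ := mem_map.1 (mem_coe.1 hu')
    cases hj
  · rintro _ _ ⟨i, -, j, -, -, ⟨rfl, rfl⟩ | ⟨rfl, rfl⟩⟩ <;> simp
  · rintro (i | i) <;> simp

/-- Blow-ups of a colored bipartite graph on `4 + 4` vertices (`col i j` is the color of the edge
`ij`, if there is one), with parts of sizes `z` and `w`. -/
lemma exists_blowup {n D t : ℕ} (hn : 0 < n) (col : Fin 4 → Fin 4 → Option Bool)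
    (z w : Fin 4 → ℕ) (hz : ∑ i, z i = n) (hw : ∑ i, w i = n)
    (labX labY : Bool → Fin 4 → Fin 4) (covX covY : Bool → Fin 4 → Bool)
    (hcol : ∀ c i j, col i j = some c → labX c i = labY c j ∧ (covX c i ∨ covY c j))
    (hcov : ∀ c a, (∑ i, if covX c i ∧ labX c i = a then z i else 0) +
      (∑ j, if covY c j ∧ labY c j = a then w j else 0) ≤ t)
    (hdegX : ∀ i, 0 < z i → D ≤ ∑ j, if (col i j).isSome then w j else 0)
    (hdegY : ∀ j, 0 < w j → D ≤ ∑ i, if (col i j).isSome then z i else 0)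
    (hD : (∃ i, 0 < z i ∧ (∑ j, if (col i j).isSome then w j else 0) = D) ∨
      ∃ j, 0 < w j ∧ (∑ i, if (col i j).isSome then z i else 0) = D) :
    ∃ (G : SimpleGraph (Fin n ⊕ Fin n)) (_ : DecidableRel G.Adj)
      (R B : SimpleGraph (Fin n ⊕ Fin n)), IsBalancedBipartite G n ∧ G.minDegree = D ∧
        IsTwoColoring G R B ∧ Disjoint R B ∧ ∀ m, HasMonoCycleOfOrder R B m → m ≤ 2 * t := by
  obtain ⟨f, hf⟩ := exists_fibers z hz
  obtain ⟨g, hg⟩ := exists_fibers w hw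
  have hfpos : ∀ x, 0 < z (f x) := fun x => by
    rw [← hf]; exact card_pos.2 ⟨x, by simp⟩
  have hgpos : ∀ x, 0 < w (g x) := fun x => by
    rw [← hg]; exact card_pos.2 ⟨x, by simp⟩
  let Γ : Bool → SimpleGraph (Fin n ⊕ Fin n) := fun c =>
    bipartiteOn univ univ fun x y => col (f x) (g y) = some c
  let G : SimpleGraph (Fin n ⊕ Fin n) :=
    bipartiteOn univ univ fun x y => (col (f x) (g y)).isSome
  have hdX : ∀ x, G.degree (.inl x) = ∑ j, if (col (f x) j).isSome then w j else 0 := fun x => by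
    rw [degree_bipartiteOn_inl]
    convert card_filter_fibers hg fun j => (col (f x) j).isSome
  have hdY : ∀ y, G.degree (.inr y) = ∑ i, if (col i (g y)).isSome then z i else 0 := fun y => by
    rw [degree_bipartiteOn_inr]
    convert card_filter_fibers hf fun i => (col i (g y)).isSome
  have hcyc : ∀ c m, HasCycleOfOrder (Γ c) m → m ≤ 2 * t := by
    intro c m
    refine le_of_hasCycleOfOrder (Sum.elim (fun x => labX c (f x)) fun y => labY c (g y))
      (T := univ.filter (Sum.elim (fun x => covX c (f x)) fun y => covY c (g y))) ?_ ?_ ?_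
    · rintro _ _ ⟨x, -, y, -, h, ⟨rfl, rfl⟩ | ⟨rfl, rfl⟩⟩
      · exact (hcol c _ _ h).1
      · exact (hcol c _ _ h).1.symm
    · rintro _ _ ⟨x, -, y, -, h, ⟨rfl, rfl⟩ | ⟨rfl, rfl⟩⟩
      · simpa using (hcol c _ _ h).2
      · simpa using (hcol c _ _ h).2.symm
    · intro a
      refine le_trans (Eq.le ?_) (hcov c a)
      rw [filter_filter, card_filter, Fintype.sum_sum_type]
      congr 1
      · have h : #{x | covX c (f x) ∧ labX c (f x) = a} =
            ∑ i, if covX c i ∧ labX c i = a then z i else 0 := by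
          convert card_filter_fibers hf fun i => covX c i ∧ labX c i = a
        rw [← h, card_filter]
        exact sum_congr rfl fun x _ => by congr
      · have h : #{x | covY c (g x) ∧ labY c (g x) = a} =
            ∑ j, if covY c j ∧ labY c j = a then w j else 0 := by
          convert card_filter_fibers hg fun j => covY c j ∧ labY c j = a
        rw [← h, card_filter]
        exact sum_congr rfl fun x _ => by congr
  refine ⟨G, inferInstance, Γ true, Γ false, isBalancedBipartite_bipartiteOn _, ?_, ?_, ?_, ?_⟩
  · have : Nonempty (Fin n ⊕ Fin n) := ⟨.inl ⟨0, hn⟩⟩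
    apply le_antisymm
    · rcases hD with ⟨i, hi, h⟩ | ⟨j, hj, h⟩
      · obtain ⟨x, hx⟩ := card_pos.1 (hi.trans_eq (hf i).symm)
        simp only [mem_filter, mem_univ, true_and] at hx
        subst hx
        exact (G.minDegree_le_degree (.inl x)).trans ((hdX x).trans h).le
      · obtain ⟨x, hx⟩ := card_pos.1 (hj.trans_eq (hg j).symm)
        simp only [mem_filter, mem_univ, true_and] at hx
        subst hx
        exact (G.minDegree_le_degree (.inr x)).trans ((hdY x).trans h).le
    · refine G.le_minDegree_of_forall_le_degree _ ?_
      rintro (x | y)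
      · exact (hdegX _ (hfpos x)).trans (hdX x).ge
      · exact (hdegY _ (hgpos y)).trans (hdY y).ge
  · ext u v
    simp only [SimpleGraph.sup_adj, Γ, G, bipartiteOn, mem_univ, true_and]
    constructor
    · rintro (⟨x, y, h, h'⟩ | ⟨x, y, h, h'⟩) <;> exact ⟨x, y, by rw [h]; rfl, h'⟩
    · rintro ⟨x, y, h, h'⟩
      obtain ⟨c, hc⟩ := Option.isSome_iff_exists.1 h
      cases c
      · exact Or.inr ⟨x, y, hc, h'⟩
      · exact Or.inl ⟨x, y, hc, h'⟩
  · rw [SimpleGraph.disjoint_left]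
    rintro _ _ ⟨x, -, y, -, h, ⟨rfl, rfl⟩ | ⟨rfl, rfl⟩⟩ ⟨x', -, y', -, h', ⟨h1, h2⟩ | ⟨h1, h2⟩⟩
    all_goals cases h1
    all_goals cases h2
    all_goals
      rw [h] at h'
      cases h'
  · rintro m (h | h)
    exacts [hcyc _ m h, hcyc _ m h]

end UpperBound

/-! ### Extremal colorings for the three ranges of the degree. -/

section Constructions

open Finset
open scoped Classical

/-- There is a coloring of a graph of minimum degree `D` whose monochromatic cycles have order at
most `l`. -/
def HasExtremalColoring (n D l : ℕ) : Prop :=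
  ∃ (G : SimpleGraph (Fin n ⊕ Fin n)) (_ : DecidableRel G.Adj)
    (R B : SimpleGraph (Fin n ⊕ Fin n)), IsBalancedBipartite G n ∧ G.minDegree = D ∧
      IsTwoColoring G R B ∧ Disjoint R B ∧ ∀ m, HasMonoCycleOfOrder R B m → m ≤ l

/-- The covering part of each class is a single part, of size at most `(D + 1) / 2`. -/
lemma hasExtremalColoring_of_le_two_thirds {n D : ℕ} (hn : 0 < n) (hD : 3 * D ≤ 2 * n) :
    HasExtremalColoring n D (2 * ((D + 1) / 2)) := by
  let z : Fin 4 → ℕ := ![n - 2 * ((D + 1) / 2) - D / 2, (D + 1) / 2, D / 2, (D + 1) / 2]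
  have hz : ∑ i, z i = n := by simp [z, Fin.sum_univ_four]; omega
  refine exists_blowup hn
    ![![none, some false, some true, none], ![some false, none, some true, some false],
      ![none, some false, none, some true], ![some true, some true, some false, none]]
    z z hz hz (fun c => if c then ![0, 0, 2, 1] else ![1, 2, 1, 0])
    (fun c => if c then ![1, 1, 0, 2] else ![2, 1, 0, 2])
    (fun c => if c then ![false, false, false, true] else ![false, true, false, false])
    (fun c => if c then ![false, false, true, true] else ![false, true, true, false])
    (by decide) ?_ ?_ ?_ ?_
  · intro c a
    cases c <;> fin_cases a <;> simp [z, Fin.sum_univ_four] <;> omega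
  · intro i _
    fin_cases i <;> simp [z, Fin.sum_univ_four] <;> omega
  · intro i _
    fin_cases i <;> simp [z, Fin.sum_univ_four] <;> omega
  · rcases Nat.eq_zero_or_pos D with rfl | h
    · exact Or.inl ⟨0, by simp [z]; omega, by simp [z, Fin.sum_univ_four]⟩
    -- Part `0` may be empty when `D > 0`, so the degree `D` is read off at part `3` of the other
    -- side.
    · exact Or.inr ⟨3, by simp [z]; omega, by simp [z, Fin.sum_univ_four]; omega⟩

/-- Each part misses exactly one part of the other side, of size `n - D` or `3 * D - 2 * n ≤ n - D`.
The largest covers join one part of each size, giving `2 * D - n`. -/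
lemma hasExtremalColoring_of_le_three_quarters {n D : ℕ} (hn : 0 < n) (hD : 2 * n ≤ 3 * D)
    (hD' : 4 * D ≤ 3 * n) : HasExtremalColoring n D (2 * (2 * D - n)) := by
  let z : Fin 4 → ℕ := ![n - D, n - D, n - D, n - 3 * (n - D)]
  have hz : ∑ i, z i = n := by simp [z, Fin.sum_univ_four]; omega
  refine exists_blowup hn
    ![![some true, some false, none, some true], ![some true, none, some false, some true],
      ![none, some true, some true, some false], ![some false, some true, some true, none]]
    z z hz hz (fun c => if c then ![0, 0, 1, 1] else ![0, 2, 1, 3])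
    (fun c => if c then ![0, 1, 1, 0] else ![3, 0, 2, 1])
    (fun c => if c then ![false, false, true, true] else ![true, true, false, true])
    (fun c => if c then ![true, false, false, true] else ![false, false, false, true])
    (by decide) ?_ ?_ ?_ ?_
  · intro c a
    cases c <;> fin_cases a <;> simp [z, Fin.sum_univ_four] <;> omega
  · intro i _
    fin_cases i <;> simp [z, Fin.sum_univ_four] <;> omega
  · intro i _
    fin_cases i <;> simp [z, Fin.sum_univ_four] <;> omega
  · exact Or.inl ⟨0, by simp [z]; omega, by simp [z, Fin.sum_univ_four]; omega⟩

/-- Both sides are cut roughly in half for one color and crosswise for the other. The one vertex of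
part `0` misses `n - D` vertices, which makes the minimum degree exactly `D`; the last part on each
side is empty. -/
lemma hasExtremalColoring_of_three_quarters_le {n D : ℕ} (hn : 0 < n) (hD : 3 * n ≤ 4 * D)
    (hD' : D ≤ n) : HasExtremalColoring n D (2 * ((n + 1) / 2)) := by
  let z : Fin 4 → ℕ := ![1, (n + 1) / 2 - 1, n / 2, 0]
  let w : Fin 4 → ℕ := ![(n + 1) / 2, D - (n + 1) / 2, n - D, 0]
  have hz : ∑ i, z i = n := by simp [z, Fin.sum_univ_four]; omega
  have hw : ∑ i, w i = n := by simp [w, Fin.sum_univ_four]; omega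
  refine exists_blowup hn
    ![![some true, some false, none, none], ![some true, some false, some false, none],
      ![some false, some true, some true, none], ![none, none, none, none]]
    z w hz hw (fun c => if c then ![0, 0, 1, 0] else ![0, 0, 1, 0])
    (fun c => if c then ![0, 1, 1, 0] else ![1, 0, 0, 0])
    (fun c => if c then ![false, false, true, false] else ![true, true, true, false])
    (fun c => if c then ![true, false, false, false] else ![false, false, false, false])
    (by decide) ?_ ?_ ?_ ?_
  · intro c a
    cases c <;> fin_cases a <;> simp [z, w, Fin.sum_univ_four] <;> omega
  · intro i
    fin_cases i <;> simp [z, w, Fin.sum_univ_four] <;> omega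
  · intro i
    fin_cases i <;> simp [z, w, Fin.sum_univ_four] <;> omega
  · exact Or.inl ⟨0, by simp [z], by simp [w, Fin.sum_univ_four]; omega⟩

theorem exists_hasExtremalColoring {δ ε : ℝ} (hδ0 : 0 ≤ δ) (hδ1 : δ ≤ 1) (hε : 0 < ε) :
    ∃ n₀ : ℕ, ∀ n : ℕ, n₀ ≤ n → ∃ l : ℕ, (l : ℝ) ≤ (circBound δ + ε) * n ∧
      HasExtremalColoring n ⌈δ * n⌉₊ l := by
  obtain ⟨N, hN⟩ := exists_nat_ge (5 / ε)
  rw [div_le_iff₀ hε] at hN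
  -- Rounding may push `D` across a threshold. The bound `13` keeps `4 * D > 3 * n` from occurring
  -- with `δ ≤ 2 / 3`; if it occurs with `δ ≤ 3 / 4`, then `4 * δ * n - 2 * n > n - 4`, and `n + 1`
  -- is reached with the slack `ε * n ≥ 5`.
  refine ⟨max N 13, fun n hn => ?_⟩
  have hn0 : 13 ≤ n := (le_max_right _ _).trans hn
  have hn0' : (13 : ℝ) ≤ n := by exact_mod_cast hn0
  have hεn : 5 ≤ ε * n := by
    have : (N : ℝ) ≤ n := by exact_mod_cast (le_max_left _ _).trans hn
    nlinarith
  obtain ⟨D, hDdef⟩ : ∃ D, D = ⌈δ * n⌉₊ := ⟨_, rfl⟩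
  rw [← hDdef]
  have h1 : δ * n ≤ D := hDdef ▸ Nat.le_ceil _
  have h2 : (D : ℝ) < δ * n + 1 := hDdef ▸ Nat.ceil_lt_add_one (by positivity)
  have hDn : D ≤ n := by
    rw [hDdef, Nat.ceil_le]
    nlinarith
  by_cases c1 : 3 * D ≤ 2 * n
  · refine ⟨_, ?_, hasExtremalColoring_of_le_two_thirds (by omega) c1⟩
    have h3 : ((2 * ((D + 1) / 2) : ℕ) : ℝ) ≤ D + 1 := by
      exact_mod_cast (by omega : 2 * ((D + 1) / 2) ≤ D + 1)
    have := le_circBound hδ1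
    nlinarith
  by_cases c2 : 4 * D ≤ 3 * n
  · refine ⟨_, ?_, hasExtremalColoring_of_le_three_quarters (by omega) (by omega) c2⟩
    have h3 : ((2 * (2 * D - n) : ℕ) : ℝ) = 4 * D - 2 * n := by
      rw [Nat.cast_mul, Nat.cast_sub (by omega)]
      push_cast
      ring
    have c2' : (4 * D : ℝ) ≤ 3 * n := by exact_mod_cast c2
    rw [h3, circBound]
    split_ifs <;> nlinarith
  · refine ⟨_, ?_, hasExtremalColoring_of_three_quarters_le (by omega) (by omega) hDn⟩
    have h3 : ((2 * ((n + 1) / 2) : ℕ) : ℝ) ≤ n + 1 := by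
      exact_mod_cast (by omega : 2 * ((n + 1) / 2) ≤ n + 1)
    have c2' : (3 * n : ℝ) ≤ 4 * D := by exact_mod_cast (by omega : 3 * n ≤ 4 * D)
    refine h3.trans ?_
    rw [circBound]
    split_ifs <;> nlinarith

end Constructions

/-! ### Minimum degree and the final theorem. -/

section MinimumDegree

open Finset
open scoped Classical

lemma le_card_of_minDegree {V : Type*} [Fintype V] {G : SimpleGraph V} {X Y : Finset V}
    (h : G.IsBipartiteWith (X : Set V) (Y : Set V)) {x : V} (hx : x ∈ X) :
    G.minDegree ≤ #{y ∈ Y | G.Adj x y} := by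
  refine (G.minDegree_le_degree x).trans ?_
  rw [← SimpleGraph.card_neighborFinset_eq_degree]
  refine card_le_card fun y hy => ?_
  rw [SimpleGraph.mem_neighborFinset] at hy
  exact mem_filter.2 ⟨h.mem_of_mem_adj hx hy, hy⟩

end MinimumDegree

theorem theorem2 (δ ε : ℝ) (hδ0 : 0 ≤ δ) (hδ1 : δ ≤ 1) (hε : 0 < ε) :
    -- the lower bound on the order of a longest monochromatic cycle
    (0 < δ → ∃ n₀ : ℕ, ∀ n : ℕ, n₀ ≤ n →
      ∀ (V : Type*) [Fintype V] (G : SimpleGraph V) [DecidableRel G.Adj],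
        IsBalancedBipartite G n → δ * (n : ℝ) ≤ (G.minDegree : ℝ) →
        ∀ R B : SimpleGraph V, IsTwoColoring G R B →
          ∃ m : ℕ, (circBound δ - ε) * (n : ℝ) ≤ (m : ℝ) ∧ HasMonoCycleOfOrder R B m) ∧
    -- the lower bound is asymptotically tight
    (∃ n₀ : ℕ, ∀ n : ℕ, n₀ ≤ n →
      ∃ (G : SimpleGraph (Fin n ⊕ Fin n)) (_ : DecidableRel G.Adj)
        (R B : SimpleGraph (Fin n ⊕ Fin n)),
        IsBalancedBipartite G n ∧ G.minDegree = ⌈δ * (n : ℝ)⌉₊ ∧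
        IsTwoColoring G R B ∧ Disjoint R B ∧
        ∀ m : ℕ, HasMonoCycleOfOrder R B m → (m : ℝ) ≤ (circBound δ + ε) * (n : ℝ)) := by
  classical
  refine ⟨fun hδ => ?_, ?_⟩
  · obtain ⟨n₀, h⟩ := exists_mono_cycle hδ hε
    refine ⟨n₀, fun n hn V _ G _ hG hdeg R B hRB => ?_⟩
    obtain ⟨X, Y, hXY, -, hX, hY⟩ := hG
    let r : Bool → SimpleGraph V := fun c => if c then R else B
    have hr : ∀ u v, G.Adj u v ↔ ∃ c, (r c).Adj u v := fun u v => by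
      rw [← show R ⊔ B = G from hRB, SimpleGraph.sup_adj]
      simp [r, or_comm]
    refine h n hn V X Y (Finset.disjoint_coe.1 hXY.disjoint) hX hY r (fun x hx => ?_)
      fun y hy => ?_
    · refine hdeg.trans ?_
      have := le_card_of_minDegree hXY hx
      simp only [hr] at this
      exact_mod_cast (by convert this)
    · refine hdeg.trans ?_
      have := le_card_of_minDegree hXY.symm hy
      simp only [G.adj_comm y, hr] at this
      exact_mod_cast (by convert this)
  · obtain ⟨n₀, h⟩ := exists_hasExtremalColoring hδ0 hδ1 hε
    refine ⟨n₀, fun n hn => ?_⟩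
    obtain ⟨l, hl, G, hG, R, B, hbal, hmin, hcol, hdis, hcyc⟩ := h n hn
    exact ⟨G, hG, R, B, hbal, hmin, hcol, hdis,
      fun m hm => le_trans (by exact_mod_cast hcyc m hm) hl⟩
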